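/- Let $\xi_1,\xi_2,\dots$ be independent identically distributed real random variables on a probability space $(\Omega,\mathcal F,\mathbb P)$ with mean zero and finite variance $\sigma^2$, where $\sigma>0$. Put $S_0=0$, $S_i=\xi_1+\dots+\xi_i$, and for $n\ge1$ let $X^n=(X^n_t)_{0\le t\le1}$ be the random element of $C=C[0,1]$ (with the uniform metric and its Borel $\sigma$-algebra) which takes the value $X^n_{i/n}=S_i/(\sigma\sqrt n)$ at $t=i/n$, $i=0,\dots,n$, and is linear in $t$ between these points. Let $P_n$ be the distribution of $X^n$ on $C$, let $\pi_{t_1,\dots,t_k}(x)=(x(t_1),\dots,x(t_k))$ for $x\in C$, and let $\Phi(z)=\frac1{\sqrt{2\pi}}\int_{-\infty}^z e^{-u^2/2}\,du$. Then: (a) For all $0\le t_1\le\dots\le t_k\le1$, $P_n\pi_{t_1,\dots,t_k}^{-1}$ converges weakly to a (possibly degenerate) Gaussian distribution $\mu_{t_1,\dots,t_k}$ on $\mathbb R^k$ satisfying, for all $\alpha_1,\dots,\alpha_k\in\mathbb R$, \[ \mu_{t_1,\dots,t_k}\{(x_1,\dots,x_k): x_i-x_{i-1}\le\alpha_i,\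 i=1,\dots,k\}=\prod_{i=1}^k\Phi\Big(\frac{\alpha_i}{\sqrt{t_i-t_{i-1}}}\Big),\qquad x_0=0,\ t_0=0, \] where a factor with $t_i=t_{i-1}$ is read as $1$ if $\alpha_i\ge0$ and as $0$ if $\alpha_i<0$. (b) The sequence $(P_n)_{n\ge1}$ is tight. (c) There is exactly one probability measure $\mathbb W$ on $C$ (Wiener measure) such that, for all $0\le t_1\le\dots\le t_k\le1$, $\mathbb W\pi_{t_1,\dots,t_k}^{-1}$ is Gaussian and satisfies the formula in (a); and $X^n$ converges in distribution in $C$ to the standard Wiener process $W$, that is, to the coordinate process $W_t(x)=x(t)$ on $C$ under $\mathbb W$. -/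

import Mathlib

open MeasureTheory ProbabilityTheory Filter Topology

/-- The space `C(unitInterval, ℝ)` of continuous functions on `[0,1]` (whose topology is that of the uniform
metric) carries its Borel `σ`-algebra. -/
instance instMeasurableSpaceC01 : MeasurableSpace C(unitInterval, ℝ) := borel _

instance instBorelSpaceC01 : BorelSpace C(unitInterval, ℝ) := ⟨rfl⟩

/-- The function on `[0, ∞)` which takes the value `a i` at each natural number `i` and is linear
between consecutive natural numbers. -/
noncomputable def linInterp (a : ℕ → ℝ) (u : ℝ) : ℝ :=
  AffineMap.lineMap (a ⌊u⌋₊) (a (⌊u⌋₊ + 1)) (u - ⌊u⌋₊)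

theorem linInterp_eq_sum (a : ℕ → ℝ) {u : ℝ} (hu : 0 ≤ u) {N : ℕ} (hN : u < N) :
    linInterp a u =
      a 0 + ∑ i ∈ Finset.range N, max 0 (min 1 (u - i)) * (a (i + 1) - a i) := by
  have h1 := Nat.floor_le hu
  have h2 := Nat.lt_floor_add_one u
  have hlow : ∀ n ≤ ⌊u⌋₊,
      a 0 + ∑ i ∈ Finset.range n, max 0 (min 1 (u - i)) * (a (i + 1) - a i) = a n := by
    intro n
    induction n with
    | zero => intro _; simp
    | succ n ih =>
      intro hn
      have hc : ((n : ℝ) + 1) ≤ ⌊u⌋₊ := by exact_mod_cast hn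
      rw [Finset.sum_range_succ, ← add_assoc, ih (by omega), min_eq_left (by linarith),
        max_eq_right zero_le_one]
      ring
  have hhigh : ∀ n, ⌊u⌋₊ + 1 ≤ n →
      a 0 + ∑ i ∈ Finset.range n, max 0 (min 1 (u - i)) * (a (i + 1) - a i) = linInterp a u := by
    intro n hn
    induction n, hn using Nat.le_induction with
    | base =>
      rw [Finset.sum_range_succ, ← add_assoc, hlow _ le_rfl, min_eq_right (by linarith),
        max_eq_right (by linarith), linInterp, AffineMap.lineMap_apply_ring']
      ring
    | succ n hn ih =>
      have hc : ((⌊u⌋₊ : ℝ) + 1) ≤ n := by exact_mod_cast hn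
      rw [Finset.sum_range_succ, ← add_assoc, ih,
        max_eq_left ((min_le_right _ _).trans (by linarith))]
      ring
  exact (hhigh N (Nat.succ_le_of_lt ((Nat.floor_lt hu).2 hN))).symm

/-- The polygonal element of `C[0,1]` which takes the value `a i` at `i / n` for `i = 0, …, n` and
is linear between these points. -/
noncomputable def polygonal (n : ℕ) (a : ℕ → ℝ) : C(unitInterval, ℝ) where
  toFun t := linInterp a (n * (t : ℝ))
  continuous_toFun := by
    have h : (fun t : unitInterval => linInterp a (n * (t : ℝ))) = fun t : unitInterval =>
        a 0 + ∑ i ∈ Finset.range (n + 1),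
          max 0 (min 1 ((n : ℝ) * (t : ℝ) - i)) * (a (i + 1) - a i) := by
      funext t
      refine linInterp_eq_sum a (mul_nonneg n.cast_nonneg t.2.1) ?_
      have := mul_le_mul_of_nonneg_left t.2.2 (Nat.cast_nonneg (α := ℝ) n)
      push_cast
      linarith
    rw [h]
    fun_prop

/-- The partial sums `S_n = ξ_1 + ⋯ + ξ_n`; the random variable `ξ_{i+1}` is `ξ i`. -/
def partialSum {Ω : Type*} (ξ : ℕ → Ω → ℝ) (n : ℕ) (ω : Ω) : ℝ :=
  ∑ i ∈ Finset.range n, ξ i ω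

/-- The process `X^n`: polygonal interpolation of the values `S_i / (σ √n)` at the points `i / n`. -/
noncomputable def scaledWalk {Ω : Type*} (ξ : ℕ → Ω → ℝ) (σ : ℝ) (n : ℕ) (ω : Ω) : C(unitInterval, ℝ) :=
  polygonal n fun i => partialSum ξ i ω / (σ * √n)

/-- The standard normal distribution function `Φ`. -/
noncomputable def stdNormalCDF (z : ℝ) : ℝ :=
  1 / √(2 * Real.pi) * ∫ u in Set.Iic z, Real.exp (-(u ^ 2) / 2)

/-- `Φ (α / √s)`, the distribution function of the centered normal law with variance `s`; for
`s = 0`, that of the unit mass at `0`. -/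
noncomputable def incrementCDF (s α : ℝ) : ℝ :=
  if s = 0 then (if 0 ≤ α then 1 else 0) else stdNormalCDF (α / √s)

/-- The increments `x_i - x_{i-1}`, `i = 1, …, k`, of a vector, with the convention `x_0 = 0`. -/
def increment {k : ℕ} (x : Fin k → ℝ) (i : Fin k) : ℝ :=
  x i - if 0 < i.1 then x ⟨i.1 - 1, lt_of_le_of_lt (Nat.sub_le _ _) i.2⟩ else 0

/-- `μ` is the law `μ_{t_1,…,t_k}`: a Gaussian law on `ℝ^k` for which the probability that
`x_i - x_{i-1} ≤ α_i` for all `i` is the product of the `Φ (α_i / √(t_i - t_{i-1}))`. -/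
structure IsWienerMarginal {k : ℕ} (t : Fin k → unitInterval) (μ : Measure (Fin k → ℝ)) : Prop where
  isGaussian : IsGaussian μ
  increments : ∀ α : Fin k → ℝ, μ.real {x | ∀ i, increment x i ≤ α i} =
    ∏ i, incrementCDF (increment (fun j => (t j : ℝ)) i) (α i)

/-- The projection `π_{t_1,…,t_k} : C[0,1] → ℝ^k`. -/
def timeProj {k : ℕ} (t : Fin k → unitInterval) (x : C(unitInterval, ℝ)) : Fin k → ℝ := fun i => x (t i)

/-- `W` is Wiener measure: a probability measure on `C[0,1]` with finite-dimensional distributions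
`μ_{t_1,…,t_k}`. -/
def IsWienerMeasure (W : ProbabilityMeasure C(unitInterval, ℝ)) : Prop :=
  ∀ (k : ℕ) (t : Fin k → unitInterval), Monotone t →
    IsWienerMarginal t ((W : Measure C(unitInterval, ℝ)).map (timeProj t))

/-! Dividing the `ξ i` by `σ` reduces everything to unit variance. Increments of the walk over
disjoint time intervals are sums over disjoint index sets, hence independent, and each obeys a
central limit theorem (`tendsto_map_inv_sqrt_mul_sum`); the product of the limits, pushed forward by
the partial-sum map, is `wienerMarginal`. Interpolation changes each coordinate by at most one step
divided by `√n`, which is negligible in probability, so (a) follows by Slutsky's argument.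

For (b), the walk is cut into `M` blocks of about `n / M` steps. The central limit theorem and a
Gaussian tail bound give probability `O(M⁻²)` that a block sum reaches `ε √n`; Ottaviani's
inequality extends this to the maximum within the block, and summing over the blocks leaves
`O(M⁻¹)`. So the modulus of continuity at `1 / M` is small with high probability, uniformly in large
`n`, and Arzelà–Ascoli turns this into tightness.

For (c), Prokhorov's theorem makes the closure of the set of laws compact, and by (a) every cluster
point has the Wiener marginals, which gives existence. The marginals determine a law on `C[0,1]`,
since evaluation on a countable dense set embeds this space in `ℝ^ℕ`; hence the cluster point is
unique and the whole sequence converges to it. -/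

/-! ### Central limit theorem by characteristic functions. -/

/-- If the characteristic function `φ` of a centered law with unit variance is compared with that of
the standard normal law, the difference at `t / √n` is negligible compared with `1 / n`. -/
lemma tendsto_mul_norm_charFun_sub {Ω : Type*} [MeasurableSpace Ω] {P : Measure Ω}
    [IsProbabilityMeasure P] {X : Ω → ℝ} (hX : AEMeasurable X P) (h0 : P[X] = 0)
    (h1 : P[X ^ 2] = 1) (t : ℝ) :
    Tendsto (fun n : ℕ => (n : ℝ) * ‖charFun (P.map X) ((√n)⁻¹ * t) -
      Complex.exp (-(((√n)⁻¹ * t : ℝ) : ℂ) ^ 2 / 2)‖) atTop (𝓝 0) := by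
  have hu : Tendsto (fun n : ℕ => (√n)⁻¹ * t) atTop (𝓝 0) := by
    rw [← zero_mul t]
    exact .mul_const t (tendsto_inv_atTop_zero.comp <| Real.tendsto_sqrt_atTop.comp <|
      tendsto_natCast_atTop_atTop)
  have hX' := taylor_charFun_two hX h0 h1
  -- The normal law has the same second-order Taylor polynomial, which cancels in the difference.
  have hG : (fun t : ℝ => charFun ((gaussianReal 0 1).map id) t - (1 - (t : ℂ) ^ 2 / 2))
      =o[𝓝 0] fun t : ℝ => t ^ 2 := by
    refine taylor_charFun_two (P := gaussianReal 0 1) (X := id) aemeasurable_id (by simp) ?_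
    have := variance_id_gaussianReal (μ := 0) (v := 1)
    rw [variance_of_integral_eq_zero aemeasurable_id (by simp)] at this
    simpa using this
  have hd := (hX'.sub hG).comp_tendsto hu
  -- For `t = 0` the quotient by `((√n)⁻¹ * t) ^ 2` says nothing, but there both functions equal
  -- `1`.
  by_cases ht : t = 0
  · subst ht
    have : IsProbabilityMeasure (P.map X) := Measure.isProbabilityMeasure_map hX
    simp
  have hd3 := (Asymptotics.IsLittleO.tendsto_div_nhds_zero (l := atTop)
    (f := fun n : ℕ => ‖charFun (P.map X) ((√n)⁻¹ * t) -
      Complex.exp (-(((√n)⁻¹ * t : ℝ) : ℂ) ^ 2 / 2)‖)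
    (g := fun n : ℕ => ((√n)⁻¹ * t) ^ 2) ?_).mul_const (t ^ 2)
  · rw [zero_mul] at hd3
    refine hd3.congr' ?_
    filter_upwards [eventually_gt_atTop 0] with n hn
    have : (0 : ℝ) < n := by exact_mod_cast hn
    rw [mul_pow, inv_pow, Real.sq_sqrt this.le]
    field_simp
  · refine (hd.norm_left).congr_left fun n => ?_
    simp only [Function.comp]
    congr 1
    rw [Measure.map_id, charFun_gaussianReal]
    push_cast
    simp
    ring_nf

/-- Turns an `o(1 / n)` comparison of single factors into an `o(1)` comparison of products of `O(n)`
factors. -/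
lemma norm_pow_sub_pow_le {a b : ℂ} (ha : ‖a‖ ≤ 1) (hb : ‖b‖ ≤ 1) (m : ℕ) :
    ‖a ^ m - b ^ m‖ ≤ m * ‖a - b‖ := by
  induction m with
  | zero => simp
  | succ m ih =>
    have : a ^ (m + 1) - b ^ (m + 1) = a * (a ^ m - b ^ m) + (a - b) * b ^ m := by ring
    rw [this]
    refine (norm_add_le _ _).trans ?_
    rw [norm_mul, norm_mul, norm_pow]
    have h1 : ‖a‖ * ‖a ^ m - b ^ m‖ ≤ m * ‖a - b‖ :=
      (mul_le_of_le_one_left (norm_nonneg _) ha).trans ih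
    have h2 : ‖a - b‖ * ‖b‖ ^ m ≤ ‖a - b‖ :=
      mul_le_of_le_one_right (norm_nonneg _) (pow_le_one₀ (norm_nonneg _) hb)
    push_cast
    linarith

section Walk

variable {Ω : Type*} [MeasurableSpace Ω] {P : Measure Ω} {ξ : ℕ → Ω → ℝ}

lemma charFun_map_mul_sum (hmeas : ∀ i, Measurable (ξ i)) (hindep : iIndepFun ξ P)
    (hident : ∀ i, IdentDistrib (ξ i) (ξ 0) P P) (c : ℝ) (S : Finset ℕ) (t : ℝ) :
    charFun (P.map fun ω => c * ∑ j ∈ S, ξ j ω) t = charFun (P.map (ξ 0)) (c * t) ^ S.card := by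
  rw [charFun_map_mul_comp,
    (hindep.restrict _).charFun_map_fun_finsetSum_eq_prod fun _ _ => (hmeas _).aemeasurable]
  · simp [fun i => (hident i).map_eq]
  · exact Finset.aemeasurable_fun_sum _ fun _ _ => (hmeas _).aemeasurable

variable [IsProbabilityMeasure P]

/-- Sums over finite index sets have the same law if the index sets have the same size. -/
lemma map_sum_eq_of_card_eq (hmeas : ∀ i, Measurable (ξ i)) (hindep : iIndepFun ξ P)
    (hident : ∀ i, IdentDistrib (ξ i) (ξ 0) P P) {S T : Finset ℕ} (h : S.card = T.card) :
    P.map (fun ω => ∑ j ∈ S, ξ j ω) = P.map fun ω => ∑ j ∈ T, ξ j ω := by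
  have hm : ∀ S : Finset ℕ, Measurable fun ω => ∑ j ∈ S, ξ j ω := fun S =>
    Finset.measurable_fun_sum _ fun _ _ => hmeas _
  have := fun S => Measure.isProbabilityMeasure_map (μ := P) (hm S).aemeasurable
  refine Measure.ext_of_charFun (funext fun t => ?_)
  have hS := charFun_map_mul_sum hmeas hindep hident 1 S t
  have hT := charFun_map_mul_sum hmeas hindep hident 1 T t
  simp only [one_mul] at hS hT
  rw [hS, hT, h]

/-- A central limit theorem for sums over index sets whose size is asymptotic to `s * n`. -/
lemma tendsto_map_inv_sqrt_mul_sum (hmeas : ∀ i, Measurable (ξ i)) (hindep : iIndepFun ξ P)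
    (hident : ∀ i, IdentDistrib (ξ i) (ξ 0) P P) (h0 : P[ξ 0] = 0) (h1 : P[ξ 0 ^ 2] = 1)
    {S : ℕ → Finset ℕ} {s : NNReal}
    (hs : Tendsto (fun n : ℕ => ((S n).card : ℝ) / n) atTop (𝓝 s)) :
    Tendsto (β := ProbabilityMeasure ℝ) (fun n : ℕ => ⟨P.map fun ω => (√n)⁻¹ * ∑ j ∈ S n, ξ j ω,
        Measure.isProbabilityMeasure_map
          (by have := hmeas; fun_prop)⟩)
      atTop (𝓝 ⟨gaussianReal 0 s, inferInstance⟩) := by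
  refine ProbabilityMeasure.tendsto_iff_tendsto_charFun.2 fun t => ?_
  simp only [ProbabilityMeasure.coe_mk, charFun_map_mul_sum hmeas hindep hident]
  have : IsProbabilityMeasure (P.map (ξ 0)) :=
    Measure.isProbabilityMeasure_map (hmeas 0).aemeasurable
  set φ := charFun (P.map (ξ 0))
  set u : ℕ → ℂ := fun n => Complex.exp (-(((√n)⁻¹ * t : ℝ) : ℂ) ^ 2 / 2)
  have hu : ∀ n, ‖u n‖ ≤ 1 := fun n => by
    simp only [u, ← Complex.ofReal_pow, ← Complex.ofReal_neg]
    rw [Complex.norm_exp]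
    have : (-(((√n)⁻¹ * t) ^ 2 : ℝ) / 2 : ℂ).re = -(((√n)⁻¹ * t) ^ 2) / 2 := by
      rw [← Complex.ofReal_neg]; norm_cast
    simp only [Complex.ofReal_neg, this, Real.exp_le_one_iff]
    have := sq_nonneg ((√n)⁻¹ * t)
    linarith
  have hlim : Tendsto (fun n => u n ^ (S n).card) atTop (𝓝 (charFun (gaussianReal 0 s) t)) := by
    have h2 : Tendsto (fun n : ℕ => Complex.exp (((-(((S n).card : ℝ) / n) * t ^ 2 / 2 : ℝ)) : ℂ))
        atTop (𝓝 (charFun (gaussianReal 0 s) t)) := by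
      have e : charFun (gaussianReal 0 s) t = Complex.exp ((-(s : ℝ) * t ^ 2 / 2 : ℝ) : ℂ) := by
        rw [charFun_gaussianReal]; push_cast; simp; ring_nf
      rw [e]
      refine (Complex.continuous_exp.tendsto _).comp
        ((Complex.continuous_ofReal.tendsto _).comp ?_)
      exact ((hs.neg).mul_const (t ^ 2)).div_const 2
    refine h2.congr' ?_
    filter_upwards [eventually_gt_atTop 0] with n hn
    simp only [u]
    rw [← Complex.exp_nat_mul]
    congr 1
    have hn' : (0 : ℝ) < n := by exact_mod_cast hn
    norm_cast
    rw [mul_pow, inv_pow, Real.sq_sqrt hn'.le]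
    field_simp
  -- The bound is `(card / n) * (n * ‖φ - u‖)`: the first factor converges, the second tends to `0`.
  have hdiff : Tendsto (fun n : ℕ => φ ((√n)⁻¹ * t) ^ (S n).card - u n ^ (S n).card)
      atTop (𝓝 0) := by
    have h3 := hs.mul (tendsto_mul_norm_charFun_sub (hmeas 0).aemeasurable h0 h1 t)
    rw [mul_zero] at h3
    refine squeeze_zero_norm' ?_ h3
    filter_upwards [eventually_gt_atTop 0] with n hn
    refine (norm_pow_sub_pow_le (norm_charFun_le_one _) (hu n) _).trans (le_of_eq ?_)
    have hn' : (n : ℝ) ≠ 0 := by exact_mod_cast hn.ne'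
    simp only [u]
    field_simp
  simpa using hdiff.add hlim

/-- Sums of independent random variables over pairwise disjoint index sets are independent. -/
lemma iIndepFun_sum_of_pairwise_disjoint {ι : Type*} [Fintype ι] (hmeas : ∀ i, Measurable (ξ i))
    (hindep : iIndepFun ξ P) {S : ι → Finset ℕ} (hS : Pairwise fun i j => Disjoint (S i) (S j)) :
    iIndepFun (fun l ω => ∑ j ∈ S l, ξ j ω) P := by
  have hm : ∀ S : Finset ℕ, Measurable fun ω => ∑ j ∈ S, ξ j ω := fun S =>
    Finset.measurable_fun_sum _ fun _ _ => hmeas _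
  rw [iIndepFun_iff_charFun_pi fun l => (hm (S l)).aemeasurable]
  intro t
  -- The joint characteristic function at `t` is that of the single sum of all `Y p` at `1`, and the
  -- `Y p` are independent because disjointness makes `p ↦ p.2` injective.
  let Y : (Σ l, S l) → Ω → ℝ := fun p ω => t p.1 * ξ p.2 ω
  have hinj : Function.Injective fun p : Σ l, S l => (p.2 : ℕ) := by
    rintro ⟨l, j, hj⟩ ⟨l', j', hj'⟩ h
    obtain rfl : j = j' := h
    obtain rfl : l = l' := by
      by_contra hne
      exact Finset.disjoint_left.1 (hS hne) hj hj'
    rfl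
  have hY : iIndepFun Y P :=
    (hindep.precomp hinj).comp (fun p x => t p.1 * x) fun p => by fun_prop
  have hYm : ∀ p, AEMeasurable (Y p) P := fun p => ((hmeas _).const_mul _).aemeasurable
  have h1 : charFun (P.map fun ω => WithLp.toLp 2 fun l => ∑ j ∈ S l, ξ j ω) t =
      charFun (P.map fun ω => ∑ p, Y p ω) 1 := by
    rw [charFun_apply, charFun_apply, integral_map, integral_map]
    · refine integral_congr_ae (ae_of_all _ fun ω => ?_)
      simp only [Y, Fintype.sum_sigma, ← Finset.mul_sum]
      simp [PiLp.inner_apply, Finset.sum_attach (S _) fun j => ξ j ω, mul_comm]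
    · have := hYm; fun_prop
    · fun_prop
    · have := hm; fun_prop
    · fun_prop
  rw [h1, hY.charFun_map_fun_sum_eq_prod hYm, Finset.prod_apply, Fintype.prod_sigma]
  refine Finset.prod_congr rfl fun l _ => ?_
  rw [(hindep.restrict _).charFun_map_fun_finsetSum_eq_prod fun _ _ => (hmeas _).aemeasurable,
    Finset.prod_apply, ← Finset.prod_coe_sort (S l)]
  refine Finset.prod_congr rfl fun j _ => ?_
  simp only [Y]
  rw [charFun_map_mul_comp (hmeas _).aemeasurable, mul_one]

end Walk

/-! ### Increments and the Gaussian marginals. -/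

/-- The vector with given increments, i.e. the vector of partial sums. -/
noncomputable def partialSums (k : ℕ) : (Fin k → ℝ) →L[ℝ] (Fin k → ℝ) :=
  ContinuousLinearMap.pi fun i => ∑ j ∈ Finset.Iic i, ContinuousLinearMap.proj j

lemma partialSums_apply {k : ℕ} (y : Fin k → ℝ) (i : Fin k) :
    partialSums k y i = ∑ j ∈ Finset.Iic i, y j := by
  simp [partialSums]

lemma sum_Iic_fin {k : ℕ} (y : Fin k → ℝ) (i : Fin k) :
    ∑ j ∈ Finset.Iic i, y j = y i + if 0 < i.1 then
      ∑ j ∈ Finset.Iic (⟨i.1 - 1, lt_of_le_of_lt (Nat.sub_le _ _) i.2⟩ : Fin k), y j else 0 := by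
  have h : Finset.Iic i = insert i (Finset.Iio i) := by ext; simp [le_iff_eq_or_lt]
  rw [h, Finset.sum_insert (by simp)]
  congr 1
  split_ifs with hi
  · congr 1
    ext j
    simp only [Finset.mem_Iio, Finset.mem_Iic, Fin.lt_def, Fin.le_def]
    omega
  · rw [Finset.sum_eq_zero]
    intro j hj
    simp only [Finset.mem_Iio, Fin.lt_def] at hj
    omega

lemma increment_partialSums {k : ℕ} (y : Fin k → ℝ) : increment (partialSums k y) = y := by
  funext i
  simp only [increment, partialSums_apply]
  rw [sum_Iic_fin]
  ring

lemma partialSums_increment {k : ℕ} (x : Fin k → ℝ) : partialSums k (increment x) = x := by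
  have key : ∀ (m : ℕ) (hm : m < k), partialSums k (increment x) ⟨m, hm⟩ = x ⟨m, hm⟩ := by
    intro m
    induction m with
    | zero => intro hm; rw [partialSums_apply, sum_Iic_fin]; simp [increment]
    | succ m ih =>
      intro hm
      have := ih (by omega)
      rw [partialSums_apply] at this ⊢
      rw [sum_Iic_fin]
      simp only [Nat.add_sub_cancel, Nat.succ_pos, if_true, this]
      simp [increment]
  exact funext fun i => key i.1 i.2

lemma measurable_increment {k : ℕ} : Measurable (increment : (Fin k → ℝ) → Fin k → ℝ) := by
  refine measurable_pi_lambda _ fun i => ?_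
  simp only [increment]
  split_ifs <;> fun_prop

lemma increment_nonneg {k : ℕ} {t : Fin k → unitInterval} (ht : Monotone t) (i : Fin k) :
    0 ≤ increment (fun j => (t j : ℝ)) i := by
  simp only [increment]
  split_ifs
  · exact sub_nonneg.2 (ht (by simp [Fin.le_def]))
  · simpa using (t i).2.1

/-- For `s ≠ 0` this is scaling by `√s`; for `s = 0` the law is the unit mass at `0`, which matches
the convention in `incrementCDF`. -/
lemma gaussianReal_real_Iic (s : NNReal) (α : ℝ) :
    (gaussianReal 0 s).real (Set.Iic α) = incrementCDF s α := by
  rcases eq_or_ne s 0 with rfl | hs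
  · simp only [gaussianReal_zero_var, incrementCDF, NNReal.coe_zero, if_true]
    rw [Measure.real, Measure.dirac_apply' _ measurableSet_Iic]
    by_cases h : 0 ≤ α <;> simp [h]
  · have hs' : (0 : ℝ) < s := NNReal.coe_pos.2 (pos_iff_ne_zero.2 hs)
    have hsq : 0 < √(s : ℝ) := Real.sqrt_pos.2 hs'
    have hmap : gaussianReal 0 s = (gaussianReal 0 1).map (√(s : ℝ) * ·) := by
      rw [gaussianReal_map_const_mul]
      congr 1
      · simp
      · ext; simp [Real.sq_sqrt hs'.le]
    have hpre : (√(s : ℝ) * ·) ⁻¹' Set.Iic α = Set.Iic (α / √(s : ℝ)) := by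
      ext x; simp [le_div_iff₀ hsq, mul_comm]
    rw [incrementCDF, if_neg hs'.ne', stdNormalCDF, hmap, Measure.real,
      Measure.map_apply (by fun_prop) measurableSet_Iic, hpre,
      gaussianReal_apply_eq_integral _ one_ne_zero, ENNReal.toReal_ofReal
        (integral_nonneg fun x => gaussianPDFReal_nonneg _ _ _), ← integral_const_mul]
    simp [gaussianPDFReal]

/-- The centered Gaussian law `μ_{t_1,…,t_k}`, with independent increments of variance
`t_i - t_{i-1}`. -/
noncomputable def wienerMarginal {k : ℕ} (t : Fin k → unitInterval) :
    ProbabilityMeasure (Fin k → ℝ) :=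
  (ProbabilityMeasure.pi fun i => (⟨gaussianReal 0 (increment (fun j => (t j : ℝ)) i).toNNReal,
    inferInstance⟩ : ProbabilityMeasure ℝ)).map (partialSums k).continuous.measurable.aemeasurable

lemma coe_wienerMarginal {k : ℕ} (t : Fin k → unitInterval) :
    (wienerMarginal t : Measure (Fin k → ℝ)) =
      (Measure.pi fun i => gaussianReal 0 (increment (fun j => (t j : ℝ)) i).toNNReal).map
        (partialSums k) := rfl

/-- A linear image of a product of Gaussian laws is Gaussian. Since `increment` inverts
`partialSums`, the event pulls back to a box of half-lines. -/
lemma isWienerMarginal_wienerMarginal {k : ℕ} {t : Fin k → unitInterval} (ht : Monotone t) :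
    IsWienerMarginal t (wienerMarginal t : Measure (Fin k → ℝ)) where
  isGaussian := by
    rw [coe_wienerMarginal]
    set ν := fun i => gaussianReal 0 (increment (fun j => (t j : ℝ)) i).toNNReal
    have h : IsGaussian (Measure.pi ν) := by
      have hl : ∀ i, HasGaussianLaw (fun x : Fin k → ℝ => x i) (Measure.pi ν) := fun i => ⟨by
        rw [(measurePreserving_eval ν i).map_eq]
        exact isGaussian_gaussianReal _ _⟩
      have := (iIndepFun.hasGaussianLaw hl
        (iIndepFun_pi (X := fun _ => id) fun _ => aemeasurable_id)).isGaussian_map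
      simpa using this
    infer_instance
  increments α := by
    have hmeas : MeasurableSet {x : Fin k → ℝ | ∀ i, increment x i ≤ α i} :=
      measurable_increment (measurableSet_Iic (a := α))
    rw [coe_wienerMarginal, Measure.real, Measure.map_apply (by fun_prop) hmeas]
    have : partialSums k ⁻¹' {x | ∀ i, increment x i ≤ α i} =
        Set.univ.pi fun i => Set.Iic (α i) := by
      ext y; simp [increment_partialSums, Pi.le_def]
    rw [this, Measure.pi_pi, ENNReal.toReal_prod]
    refine Finset.prod_congr rfl fun i _ => ?_
    rw [← Measure.real, gaussianReal_real_Iic, Real.coe_toNNReal _ (increment_nonneg ht i)]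

/-- Boxes of half-lines form a generating π-system, so the product formula alone fixes the law of
the increments, and `partialSums` recovers the vector. Gaussianity serves only to make `μ` finite.
-/
lemma IsWienerMarginal.eq_wienerMarginal {k : ℕ} {t : Fin k → unitInterval} (ht : Monotone t)
    {μ : Measure (Fin k → ℝ)} (h : IsWienerMarginal t μ) : μ = wienerMarginal t := by
  have := h.isGaussian
  set ν := fun i => gaussianReal 0 (increment (fun j => (t j : ℝ)) i).toNNReal
  have hpi : Measure.pi ν = μ.map increment := by
    refine Measure.pi_eq_generateFrom (C := fun _ => Set.range Set.Iic)
      (fun _ => (borel_eq_generateFrom_Iic ℝ).symm.trans (BorelSpace.measurable_eq).symm)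
      (fun _ => isPiSystem_Iic) (fun i => ⟨fun n => Set.Iic n, fun n => ⟨n, rfl⟩,
        fun n => measure_lt_top _ _, ?_⟩) ?_
    · exact Set.iUnion_eq_univ_iff.2 fun x => (exists_nat_ge x).imp fun n hn => hn
    · intro s hs
      choose α hα using hs
      obtain rfl : s = fun i => Set.Iic (α i) := funext fun i => (hα i).symm
      have hinc := h.increments α
      rw [Measure.map_apply measurable_increment (MeasurableSet.univ_pi fun i => measurableSet_Iic)]
      have hset : increment ⁻¹' (Set.univ.pi fun i => Set.Iic (α i)) =
          {x | ∀ i, increment x i ≤ α i} := by ext; simp [Pi.le_def]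
      rw [hset, ← ENNReal.toReal_eq_toReal_iff' (measure_ne_top _ _)
        (ENNReal.prod_ne_top fun _ _ => measure_ne_top _ _), ← Measure.real, hinc,
        ENNReal.toReal_prod]
      refine Finset.prod_congr rfl fun i _ => ?_
      rw [← Measure.real, gaussianReal_real_Iic, Real.coe_toNNReal _ (increment_nonneg ht i)]
  rw [coe_wienerMarginal, hpi, Measure.map_map (by fun_prop) measurable_increment]
  have : partialSums k ∘ increment = id := funext partialSums_increment
  rw [this, Measure.map_id]

/-! ### Measurability of the walk and convergence of its marginals. -/

/-- The path is a finite combination of fixed functions `φ i`, with coefficients continuous in `a`.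
Measurability of `scaledWalk` rests on this. -/
lemma continuous_polygonal (n : ℕ) : Continuous (polygonal n) := by
  let φ : ℕ → C(unitInterval, ℝ) := fun i =>
    ⟨fun t => max 0 (min 1 ((n : ℝ) * (t : ℝ) - i)), by fun_prop⟩
  have h : polygonal n = fun a => a 0 • (1 : C(unitInterval, ℝ)) +
      ∑ i ∈ Finset.range (n + 1), (a (i + 1) - a i) • φ i := by
    funext a
    ext t
    have hN : (n : ℝ) * t < (n + 1 : ℕ) := by
      have := mul_le_mul_of_nonneg_left t.2.2 (Nat.cast_nonneg (α := ℝ) n)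
      push_cast
      linarith
    have := linInterp_eq_sum a (mul_nonneg n.cast_nonneg t.2.1) hN
    simpa [polygonal, φ, mul_comm] using this
  rw [h]
  fun_prop

lemma measurable_scaledWalk {Ω : Type*} [MeasurableSpace Ω] {ξ : ℕ → Ω → ℝ}
    (hmeas : ∀ i, Measurable (ξ i)) (σ : ℝ) (n : ℕ) : Measurable (scaledWalk ξ σ n) := by
  refine (continuous_polygonal n).measurable.comp (measurable_pi_lambda _ fun i => ?_)
  unfold partialSum
  fun_prop

lemma continuous_timeProj {k : ℕ} (t : Fin k → unitInterval) : Continuous (timeProj t) :=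
  continuous_pi fun i => by simpa [timeProj] using continuous_eval_const (t i)

/-- Separates the uninterpolated walk from an error of at most one scaled step. -/
lemma scaledWalk_apply {Ω : Type*} (ξ : ℕ → Ω → ℝ) (n : ℕ) (ω : Ω) (t : unitInterval) :
    scaledWalk ξ 1 n ω t = (√n)⁻¹ * partialSum ξ ⌊(n : ℝ) * t⌋₊ ω +
      ((n : ℝ) * t - ⌊(n : ℝ) * t⌋₊) * ((√n)⁻¹ * ξ ⌊(n : ℝ) * t⌋₊ ω) := by
  simp only [scaledWalk, polygonal, ContinuousMap.coe_mk, linInterp,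
    AffineMap.lineMap_apply_ring', partialSum, Finset.sum_range_succ]
  ring

/-- `ξ` is a sequence of independent identically distributed random variables with mean zero and
unit variance. -/
structure IsStandardIID {Ω : Type*} [MeasurableSpace Ω] (ξ : ℕ → Ω → ℝ) (P : Measure Ω) :
    Prop where
  meas : ∀ i, Measurable (ξ i)
  indep : iIndepFun ξ P
  ident : ∀ i, IdentDistrib (ξ i) (ξ 0) P P
  memLp_zero : MemLp (ξ 0) 2 P
  mean_zero : P[ξ 0] = 0
  variance_zero : Var[ξ 0; P] = 1

namespace IsStandardIID

variable {Ω : Type*} [MeasurableSpace Ω] {P : Measure Ω} {ξ : ℕ → Ω → ℝ}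

lemma memLp (h : IsStandardIID ξ P) (i : ℕ) : MemLp (ξ i) 2 P :=
  (h.ident i).memLp_iff.2 h.memLp_zero

lemma mean (h : IsStandardIID ξ P) (i : ℕ) : P[ξ i] = 0 :=
  (h.ident i).integral_eq.trans h.mean_zero

lemma variance (h : IsStandardIID ξ P) (i : ℕ) : Var[ξ i; P] = 1 :=
  (h.ident i).variance_eq.trans h.variance_zero

lemma second_moment (h : IsStandardIID ξ P) : P[ξ 0 ^ 2] = 1 := by
  rw [← h.variance_zero, variance_of_integral_eq_zero (h.meas 0).aemeasurable h.mean_zero]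
  rfl

lemma measurable_sum (h : IsStandardIID ξ P) (S : Finset ℕ) :
    Measurable fun ω => ∑ j ∈ S, ξ j ω :=
  Finset.measurable_fun_sum _ fun _ _ => h.meas _

variable [IsProbabilityMeasure P]

/-- Chebyshev's inequality for sums. -/
lemma measure_le_abs_sum (h : IsStandardIID ξ P) (S : Finset ℕ) {c : ℝ} (hc : 0 < c) :
    P {ω | c ≤ |∑ j ∈ S, ξ j ω|} ≤ ENNReal.ofReal (S.card / c ^ 2) := by
  have hL : MemLp (∑ j ∈ S, ξ j) 2 P := memLp_finsetSum' S fun j _ => h.memLp j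
  have hv : Var[∑ j ∈ S, ξ j; P] = S.card := by
    rw [IndepFun.variance_sum (fun i _ => h.memLp i) fun i _ j _ hij => h.indep.indepFun hij]
    simp [h.variance]
  have hm : P[∑ j ∈ S, ξ j] = 0 := by
    simp only [Finset.sum_apply]
    rw [integral_finsetSum _ fun i _ => (h.memLp i).integrable (by norm_num)]
    simp [h.mean]
  have := meas_ge_le_variance_div_sq hL hc
  rw [hv, hm] at this
  simpa using this

/-- Convergence of the finite-dimensional distributions of the scaled walk, without interpolation. -/
lemma tendstoInDistribution_partialSum (h : IsStandardIID ξ P) {k : ℕ} {t : Fin k → unitInterval}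
    (ht : Monotone t) :
    TendstoInDistribution (fun (n : ℕ) ω (i : Fin k) => (√n)⁻¹ * partialSum ξ ⌊(n : ℝ) * t i⌋₊ ω)
      atTop (id : (Fin k → ℝ) → (Fin k → ℝ)) (fun _ => P)
      (wienerMarginal t : Measure (Fin k → ℝ)) := by
  -- Indices are shifted by one: `m n 0 = 0` encodes `t_0 = 0`, and `m n (i + 1)` belongs to `t i`.
  -- The default value beyond `k` plays no role.
  let m : ℕ → ℕ → ℕ := fun n i => if hi : 0 < i ∧ i - 1 < k then ⌊(n : ℝ) * t ⟨i - 1, hi.2⟩⌋₊ else 0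
  let S : ℕ → Fin k → Finset ℕ := fun n i => Finset.Ico (m n i) (m n (i + 1))
  have hm_succ : ∀ n (i : Fin k), m n (i + 1) = ⌊(n : ℝ) * t i⌋₊ := fun n i => by simp [m]
  have hmono : ∀ n (i j : ℕ), i ≤ j → j ≤ k → m n i ≤ m n j := by
    intro n i j hij hj
    by_cases hi : 0 < i
    · simp only [m]
      rw [dif_pos ⟨hi, by omega⟩, dif_pos ⟨by omega, by omega⟩]
      refine Nat.floor_le_floor (mul_le_mul_of_nonneg_left ?_ n.cast_nonneg)
      exact_mod_cast ht (by simp [Fin.le_def]; omega)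
    · simp [m, hi]
  have hdisj : ∀ n, Pairwise fun i j => Disjoint (S n i) (S n j) := by
    intro n
    have key : ∀ i j : Fin k, i < j → Disjoint (S n i) (S n j) := fun i j hij => by
      refine Finset.disjoint_left.2 fun x hx hx' => ?_
      have := hmono n (i + 1) j hij j.2.le
      simp only [S, Finset.mem_Ico] at hx hx'
      omega
    intro i j hij
    rcases lt_or_gt_of_ne hij with h | h
    · exact key i j h
    · exact (key j i h).symm
  have hlim : ∀ (i : ℕ), Tendsto (fun n : ℕ => (m n i : ℝ) / n) atTop
      (𝓝 (if hi : 0 < i ∧ i - 1 < k then (t ⟨i - 1, hi.2⟩ : ℝ) else 0)) := by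
    intro i
    by_cases hi : 0 < i ∧ i - 1 < k
    · simp only [m, dif_pos hi]
      refine ((tendsto_nat_floor_mul_div_atTop (t ⟨i - 1, hi.2⟩).2.1).comp
        tendsto_natCast_atTop_atTop).congr fun n => ?_
      simp [mul_comm]
    · simp [m, hi]
  have hcard : ∀ i : Fin k, Tendsto (fun n : ℕ => ((S n i).card : ℝ) / n) atTop
      (𝓝 (increment (fun j => (t j : ℝ)) i).toNNReal) := by
    intro i
    rw [Real.coe_toNNReal _ (increment_nonneg ht i)]
    have := (hlim (i + 1)).sub (hlim i)
    have e : ((if hi : 0 < (i : ℕ) + 1 ∧ (i : ℕ) + 1 - 1 < k then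
        (t ⟨(i : ℕ) + 1 - 1, hi.2⟩ : ℝ) else 0) -
        if hi : 0 < (i : ℕ) ∧ (i : ℕ) - 1 < k then (t ⟨(i : ℕ) - 1, hi.2⟩ : ℝ) else 0) =
        increment (fun j => (t j : ℝ)) i := by
      have hi1 : (i : ℕ) - 1 < k := by omega
      by_cases hi : 0 < (i : ℕ) <;> simp [increment, hi, hi1]
    rw [e] at this
    refine this.congr fun n => ?_
    rw [Nat.card_Ico, Nat.cast_sub (hmono n i (i + 1) (by omega) (by omega)), sub_div]
  have hcm : ∀ (n : ℕ) (i : Fin k), Measurable fun ω => (√n)⁻¹ * ∑ j ∈ S n i, ξ j ω :=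
    fun n i => (h.measurable_sum _).const_mul _
  -- Weak convergence of the factors gives weak convergence of the product laws; independence
  -- identifies these below with the joint laws.
  have hpi := (ProbabilityMeasure.continuous_pi.tendsto _).comp (tendsto_pi_nhds.2 fun i =>
    tendsto_map_inv_sqrt_mul_sum h.meas h.indep h.ident h.mean_zero h.second_moment (hcard i))
  have hW := ProbabilityMeasure.tendsto_map_of_tendsto_of_continuous _ _ hpi
    (partialSums k).continuous
  have hY : ∀ n : ℕ, Measurable fun ω (i : Fin k) =>
      (√n)⁻¹ * partialSum ξ ⌊(n : ℝ) * t i⌋₊ ω := fun n =>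
    measurable_pi_lambda _ fun i => (h.measurable_sum _).const_mul _
  refine ⟨fun n => (hY n).aemeasurable, aemeasurable_id, ?_⟩
  refine Tendsto.congr (fun n => Subtype.ext (Eq.symm ?_))
    (hW.trans (le_of_eq (congrArg 𝓝 (Subtype.ext Measure.map_id.symm))))
  change _ = (Measure.pi fun i => P.map fun ω => (√n)⁻¹ * ∑ j ∈ S n i, ξ j ω).map (partialSums k)
  have hind : iIndepFun (fun (i : Fin k) ω => (√n)⁻¹ * ∑ j ∈ S n i, ξ j ω) P :=
    (iIndepFun_sum_of_pairwise_disjoint h.meas h.indep (hdisj n)).comp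
      (fun _ x => (√n)⁻¹ * x) fun _ => by fun_prop
  rw [← hind.map_fun_eq_pi_map fun i => (hcm n i).aemeasurable,
    Measure.map_map (by fun_prop) (measurable_pi_lambda _ (hcm n))]
  refine congrArg (fun f => P.map f) (funext fun ω => ?_)
  rw [Function.comp, ← partialSums_increment fun i : Fin k => (√n)⁻¹ * partialSum ξ ⌊(n : ℝ) * t i⌋₊ ω]
  congr 1
  funext i
  have hS : ∑ j ∈ S n i, ξ j ω = partialSum ξ (m n (i + 1)) ω - partialSum ξ (m n i) ω := by
    simp only [S, partialSum]
    rw [Finset.sum_Ico_eq_sub _ (hmono n i (i + 1) (by omega) (by omega))]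
  rw [hS, hm_succ]
  have hi1 : (i : ℕ) - 1 < k := by omega
  by_cases hi : 0 < (i : ℕ)
  · simp [increment, hi, hi1, m, mul_sub]
  · simp [increment, hi, m, partialSum]

/-- Convergence of the finite-dimensional distributions of the scaled walk. -/
lemma tendstoInDistribution_timeProj (h : IsStandardIID ξ P) {k : ℕ} {t : Fin k → unitInterval}
    (ht : Monotone t) :
    TendstoInDistribution (fun n ω => timeProj t (scaledWalk ξ 1 n ω)) atTop
      (id : (Fin k → ℝ) → (Fin k → ℝ)) (fun _ => P)
      (wienerMarginal t : Measure (Fin k → ℝ)) := by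
  refine tendstoInDistribution_of_tendstoInMeasure_sub _ _
    (h.tendstoInDistribution_partialSum ht) ?_ fun n =>
    ((continuous_timeProj t).measurable.comp (measurable_scaledWalk h.meas 1 n)).aemeasurable
  rw [tendstoInMeasure_iff_norm]
  intro ε hε
  have hb : ∀ n : ℕ, 0 < n → P {ω | ε ≤ ‖((fun n ω => timeProj t (scaledWalk ξ 1 n ω)) -
      fun (n : ℕ) ω (i : Fin k) => (√n)⁻¹ * partialSum ξ ⌊(n : ℝ) * t i⌋₊ ω) n ω -
        (0 : Ω → Fin k → ℝ) ω‖} ≤ k * ENNReal.ofReal (1 / ε ^ 2 * (1 / (n : ℝ))) := by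
    intro n hn
    have hn' : (0 : ℝ) < √n := Real.sqrt_pos.2 (by exact_mod_cast hn)
    -- A single step is written as a sum over a singleton so that Chebyshev's inequality for sums
    -- applies.
    calc _ ≤ P (⋃ i : Fin k, {ω | ε * √n ≤ |∑ j ∈ {⌊(n : ℝ) * t i⌋₊}, ξ j ω|}) := by
          refine measure_mono fun ω hω => ?_
          by_contra hcon
          simp only [Set.mem_iUnion, Set.mem_ofPred_eq, not_exists, not_le,
            Finset.sum_singleton] at hcon
          refine absurd hω (not_le.2 ((pi_norm_lt_iff hε).2 fun i => ?_))
          simp only [Pi.sub_apply, timeProj, scaledWalk_apply, Pi.zero_apply, sub_zero,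
            add_sub_cancel_left]
          have h1 : 0 ≤ (n : ℝ) * t i := mul_nonneg n.cast_nonneg (t i).2.1
          have h2 := Nat.floor_le h1
          have h3 := Nat.lt_floor_add_one ((n : ℝ) * t i)
          rw [Real.norm_eq_abs, abs_mul, abs_of_nonneg (sub_nonneg.2 h2), abs_mul, abs_inv,
            abs_of_pos hn']
          calc _ ≤ 1 * ((√n)⁻¹ * |ξ ⌊(n : ℝ) * t i⌋₊ ω|) := by
                gcongr; linarith
            _ < ε := by
                rw [one_mul, inv_mul_lt_iff₀ hn']; exact (hcon i).trans_eq (mul_comm _ _)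
      _ ≤ ∑ i : Fin k, P {ω | ε * √n ≤ |∑ j ∈ {⌊(n : ℝ) * t i⌋₊}, ξ j ω|} :=
          measure_iUnion_fintype_le _ _
      _ ≤ ∑ i : Fin k, ENNReal.ofReal (1 / ε ^ 2 * (1 / (n : ℝ))) := by
          refine Finset.sum_le_sum fun i _ =>
            (h.measure_le_abs_sum _ (mul_pos hε hn')).trans (le_of_eq ?_)
          rw [mul_pow, Real.sq_sqrt n.cast_nonneg]
          simp [mul_comm]
      _ = _ := by simp
  have hz : Tendsto (fun n : ℕ => (k : ENNReal) * ENNReal.ofReal (1 / ε ^ 2 * (1 / (n : ℝ))))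
      atTop (𝓝 0) := by
    have h1 := (tendsto_one_div_atTop_nhds_zero_nat (𝕜 := ℝ)).const_mul (1 / ε ^ 2)
    rw [mul_zero] at h1
    have h2 := ENNReal.tendsto_ofReal h1
    rw [ENNReal.ofReal_zero] at h2
    simpa using ENNReal.Tendsto.const_mul h2 (Or.inr (ENNReal.natCast_ne_top k))
  exact tendsto_of_tendsto_of_tendsto_of_le_of_le' tendsto_const_nhds hz
    (Eventually.of_forall fun _ => zero_le) ((eventually_gt_atTop 0).mono hb)

end IsStandardIID

/-! ### Modulus of continuity, compactness and tightness in `C[0,1]`. -/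

section Modulus

/-- The set of paths in `C[0,1]` whose modulus of continuity at `δ` is at most `ε`. -/
def modulusLE (δ ε : ℝ) : Set C(unitInterval, ℝ) :=
  {x | ∀ s t : unitInterval, |(s : ℝ) - t| ≤ δ → |x s - x t| ≤ ε}

lemma modulusLE_antitone {δ δ' : ℝ} (h : δ' ≤ δ) (ε : ℝ) : modulusLE δ ε ⊆ modulusLE δ' ε :=
  fun _ hx s t hst => hx s t (hst.trans h)

lemma isClosed_modulusLE (δ ε : ℝ) : IsClosed (modulusLE δ ε) := by
  simp only [modulusLE, Set.ofPred_forall]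
  refine isClosed_iInter fun s => isClosed_iInter fun t => isClosed_iInter fun _ => ?_
  exact isClosed_le (by fun_prop) continuous_const

lemma exists_mem_modulusLE (x : C(unitInterval, ℝ)) {ε : ℝ} (hε : 0 < ε) :
    ∃ k : ℕ, x ∈ modulusLE (1 / ((k : ℝ) + 1)) ε := by
  have hx := CompactSpace.uniformContinuous_of_continuous x.continuous
  obtain ⟨δ, hδ, h⟩ := Metric.uniformContinuous_iff.1 hx ε hε
  obtain ⟨k, hk⟩ := exists_nat_one_div_lt hδ
  refine ⟨k, fun s t hst => (h ?_).le⟩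
  rw [Subtype.dist_eq, Real.dist_eq]
  exact hst.trans_lt hk

/-- A single finite measure gives small mass to paths with large modulus of continuity. -/
lemma exists_measure_compl_modulusLE_le (Q : Measure C(unitInterval, ℝ)) [IsFiniteMeasure Q]
    {ε : ℝ} (hε : 0 < ε) {η : ENNReal} (hη : 0 < η) :
    ∃ δ > 0, Q (modulusLE δ ε)ᶜ ≤ η := by
  have hanti : Antitone fun k : ℕ => (modulusLE (1 / ((k : ℝ) + 1)) ε)ᶜ := fun k l hkl =>
    Set.compl_subset_compl.2 (modulusLE_antitone (by gcongr) ε)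
  have hlim := tendsto_measure_iInter_atTop (μ := Q)
    (fun k : ℕ => (isClosed_modulusLE (1 / ((k : ℝ) + 1)) ε).measurableSet.compl.nullMeasurableSet)
    hanti ⟨0, measure_ne_top _ _⟩
  have hempty : ⋂ k : ℕ, (modulusLE (1 / ((k : ℝ) + 1)) ε)ᶜ = ∅ := by
    refine Set.eq_empty_of_forall_notMem fun x hx => ?_
    obtain ⟨k, hk⟩ := exists_mem_modulusLE x hε
    exact Set.mem_iInter.1 hx k hk
  rw [hempty, measure_empty] at hlim
  obtain ⟨k, hk⟩ := (hlim.eventually_lt_const hη).exists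
  exact ⟨1 / ((k : ℝ) + 1), by positivity, hk.le⟩

/-- Takes care of the finitely many `n` not covered by an asymptotic bound. -/
lemma exists_forall_lt_measure_compl_modulusLE_le (Q : ℕ → Measure C(unitInterval, ℝ))
    [∀ n, IsFiniteMeasure (Q n)] {ε : ℝ} (hε : 0 < ε) {η : ENNReal} (hη : 0 < η) (N : ℕ) :
    ∃ δ > 0, ∀ n < N, Q n (modulusLE δ ε)ᶜ ≤ η := by
  induction N with
  | zero => exact ⟨1, one_pos, by simp⟩
  | succ N ih =>
    obtain ⟨δ, hδ, h⟩ := ih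
    obtain ⟨δ', hδ', h'⟩ := exists_measure_compl_modulusLE_le (Q N) hε hη
    refine ⟨min δ δ', lt_min hδ hδ', fun n hn => ?_⟩
    rcases Nat.lt_succ_iff_lt_or_eq.1 hn with hn | rfl
    · exact (measure_mono (Set.compl_subset_compl.2
        (modulusLE_antitone (min_le_left _ _) ε))).trans (h n hn)
    · exact (measure_mono (Set.compl_subset_compl.2
        (modulusLE_antitone (min_le_right _ _) ε))).trans h'

/-- A function on `[0,1]` vanishing at `0` whose oscillation over distances at most `δ` is at most
`1` is bounded by any natural number `N` with `1 / N ≤ δ`. -/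
lemma abs_le_of_oscillation_le_one {f : unitInterval → ℝ} (hf0 : f 0 = 0) {δ : ℝ}
    (hf : ∀ s t : unitInterval, |(s : ℝ) - t| ≤ δ → |f s - f t| ≤ 1) {N : ℕ} (hN : 0 < N)
    (hNδ : 1 / (N : ℝ) ≤ δ) (t : unitInterval) : |f t| ≤ N := by
  have hN' : (0 : ℝ) < N := by exact_mod_cast hN
  -- The points `(j / N) * t` lead from `0` to `t` in `N` steps of length at most `δ`; each adds at
  -- most `1`.
  let p : ℕ → unitInterval := fun j => Set.projIcc 0 1 zero_le_one ((j : ℝ) / N * t)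
  have hp : ∀ j ≤ N, (p j : ℝ) = (j : ℝ) / N * t := by
    intro j hj
    have hj' : (j : ℝ) / N ≤ 1 := (div_le_one hN').2 (by exact_mod_cast hj)
    simp only [p]
    rw [Set.projIcc_of_mem zero_le_one ⟨mul_nonneg (by positivity) t.2.1,
      mul_le_one₀ hj' t.2.1 t.2.2⟩]
  have h0 : p 0 = 0 := Subtype.ext (by rw [hp 0 (zero_le)]; simp)
  have hNt : p N = t := Subtype.ext (by rw [hp N le_rfl, div_self hN'.ne', one_mul])
  have hind : ∀ j ≤ N, |f (p j)| ≤ j := by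
    intro j
    induction j with
    | zero => intro _; simp [h0, hf0]
    | succ j ih =>
      intro hj
      have h1 := ih (by omega)
      have h2 := hf (p (j + 1)) (p j) (by
        rw [hp _ hj, hp j (by omega)]
        have : ((j + 1 : ℕ) : ℝ) / N * t - (j : ℝ) / N * t = 1 / N * t := by
          push_cast; ring
        rw [this, abs_of_nonneg (mul_nonneg (by positivity) t.2.1)]
        exact (mul_le_of_le_one_right (by positivity) t.2.2).trans hNδ)
      have h3 := abs_add_le (f (p (j + 1)) - f (p j)) (f (p j))
      rw [sub_add_cancel] at h3
      push_cast
      linarith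
  simpa [hNt] using hind N le_rfl

/-- The Arzelà–Ascoli theorem in `C[0,1]` in terms of moduli of continuity. -/
lemma isCompact_setOf_modulus {δ : ℕ → ℝ} (hδ : ∀ k, 0 < δ k) :
    IsCompact ({x : C(unitInterval, ℝ) | x 0 = 0} ∩
      ⋂ k : ℕ, modulusLE (δ k) (1 / ((k : ℝ) + 1))) := by
  have hunif : ∀ ε > 0, ∃ d > 0, ∀ f : unitInterval → ℝ, (∀ (k : ℕ) (s t : unitInterval),
      |(s : ℝ) - t| ≤ δ k → |f s - f t| ≤ 1 / ((k : ℝ) + 1)) →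
      ∀ s t, dist s t < d → dist (f s) (f t) < ε := by
    intro ε hε
    obtain ⟨k, hk⟩ := exists_nat_one_div_lt hε
    refine ⟨δ k, hδ k, fun f hf s t hst => ?_⟩
    rw [Subtype.dist_eq, Real.dist_eq] at hst
    rw [Real.dist_eq]
    exact (hf k s t hst.le).trans_lt hk
  -- For `k = 0` the permitted oscillation is `1`, which yields the uniform bound `N + 1`.
  obtain ⟨N, hN⟩ := exists_nat_one_div_lt (hδ 0)
  refine ArzelaAscoli.isCompact_of_equicontinuous _ ?_ ?_
  -- The modulus conditions force continuity, so the image in the product space is cut out by closed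
  -- pointwise conditions inside a compact box.
  · have himage : ContinuousMap.toFun '' ({x : C(unitInterval, ℝ) | x 0 = 0} ∩
        ⋂ k : ℕ, modulusLE (δ k) (1 / ((k : ℝ) + 1))) =
        {f : unitInterval → ℝ | f 0 = 0} ∩ ⋂ (k : ℕ) (s : unitInterval) (t : unitInterval)
          (_ : |(s : ℝ) - t| ≤ δ k), {f | |f s - f t| ≤ 1 / ((k : ℝ) + 1)} := by
      ext f
      simp only [Set.mem_image, Set.mem_inter_iff, Set.mem_iInter, modulusLE, Set.mem_ofPred_eq]
      constructor
      · rintro ⟨x, hx, rfl⟩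
        exact hx
      · rintro ⟨hf0, hf⟩
        refine ⟨⟨f, Metric.continuous_iff.2 fun t ε hε => ?_⟩, ⟨hf0, hf⟩, rfl⟩
        obtain ⟨d, hd, h⟩ := hunif ε hε
        exact ⟨d, hd, fun s hs => h f hf s t hs⟩
    rw [himage]
    refine (isCompact_univ_pi fun _ : unitInterval =>
      isCompact_Icc (a := -((N + 1 : ℕ) : ℝ)) (b := ((N + 1 : ℕ) : ℝ))).of_isClosed_subset ?_ ?_
    · refine (isClosed_eq (by fun_prop) continuous_const).inter ?_
      refine isClosed_iInter fun k => isClosed_iInter fun s => isClosed_iInter fun t =>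
        isClosed_iInter fun _ => isClosed_le (by fun_prop) continuous_const
    · rintro f ⟨hf0, hf⟩ t -
      simp only [Set.mem_iInter, Set.mem_ofPred_eq] at hf hf0
      refine abs_le.1 (abs_le_of_oscillation_le_one hf0 (δ := δ 0) (fun s t hst => ?_)
        N.succ_pos (by push_cast; exact hN.le) t)
      simpa using hf 0 s t hst
  · intro t
    refine Metric.equicontinuousAt_iff.2 fun ε hε => ?_
    obtain ⟨d, hd, h⟩ := hunif ε hε
    refine ⟨d, hd, fun s hs x => h _ (fun k => Set.mem_iInter.1 x.2.2 k) t s ?_⟩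
    rwa [dist_comm]

/-- A tightness criterion in `C[0,1]`. -/
lemma isTightMeasureSet_of_modulus {S : Set (Measure C(unitInterval, ℝ))}
    (h0 : ∀ Q ∈ S, Q {x | x 0 = 0}ᶜ = 0)
    (h : ∀ ε : ℝ, 0 < ε → ∀ η : ENNReal, 0 < η → ∃ δ > 0, ∀ Q ∈ S, Q (modulusLE δ ε)ᶜ ≤ η) :
    IsTightMeasureSet S := by
  rw [isTightMeasureSet_iff_exists_isCompact_measure_compl_le]
  intro η hη
  obtain ⟨η', hη', hsum⟩ := ENNReal.exists_pos_sum_of_countable' hη.ne' ℕ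
  choose δ hδ hQ using fun k : ℕ => h (1 / ((k : ℝ) + 1)) (by positivity) (η' k) (hη' k)
  refine ⟨_, isCompact_setOf_modulus hδ, fun Q hQS => ?_⟩
  rw [Set.compl_inter, Set.compl_iInter]
  calc _ ≤ Q {x | x 0 = 0}ᶜ + Q (⋃ k : ℕ, (modulusLE (δ k) (1 / ((k : ℝ) + 1)))ᶜ) :=
        measure_union_le _ _
    _ ≤ 0 + ∑' k, η' k := by
        rw [h0 Q hQS]
        exact add_le_add le_rfl ((measure_iUnion_le _).trans
          (ENNReal.tsum_le_tsum fun k => hQ k Q hQS))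
    _ ≤ η := by rw [zero_add]; exact hsum.le

end Modulus

/-! ### Block oscillation, Gaussian tails and a maximal inequality. -/

section Interpolation

lemma abs_linInterp_sub_lt {a : ℕ → ℝ} {u c ε : ℝ} (hu : 0 ≤ u)
    (h1 : |a ⌊u⌋₊ - c| < ε) (h2 : |a (⌊u⌋₊ + 1) - c| < ε) : |linInterp a u - c| < ε := by
  have hu1 := Nat.floor_le hu
  have hu2 := Nat.lt_floor_add_one u
  rw [linInterp, AffineMap.lineMap_apply_ring']
  set r := u - ⌊u⌋₊
  have hr0 : 0 ≤ r := sub_nonneg.2 hu1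
  have hr1 : r < 1 := by simp only [r]; linarith
  rw [abs_lt] at *
  constructor <;> nlinarith

/-- If a sequence oscillates by less than `ε` over each of `M` blocks of length `m`, then its
interpolation oscillates by at most `3 * ε` over distances at most `m`. -/
lemma abs_linInterp_sub_linInterp_le {a : ℕ → ℝ} {ε : ℝ} {M m : ℕ} (hm : 0 < m)
    (ha : ∀ j < M, ∀ i ≤ m, |a (j * m + i) - a (j * m)| < ε) {u v : ℝ} (hu : 0 ≤ u)
    (huv : u ≤ v) (hv : v < M * m) (hd : v - u ≤ m) :
    |linInterp a u - linInterp a v| ≤ 3 * ε := by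
  have key : ∀ w : ℝ, 0 ≤ w → w < M * m →
      ⌊w⌋₊ / m < M ∧ |linInterp a w - a (⌊w⌋₊ / m * m)| < ε := by
    intro w hw hwM
    have hlt : ⌊w⌋₊ < M * m := (Nat.floor_lt hw).2 (by exact_mod_cast hwM)
    have hj : ⌊w⌋₊ / m < M := (Nat.div_lt_iff_lt_mul hm).2 hlt
    have hmod := Nat.mod_lt ⌊w⌋₊ hm
    have hdm : ⌊w⌋₊ / m * m + ⌊w⌋₊ % m = ⌊w⌋₊ := Nat.div_add_mod' _ _
    refine ⟨hj, abs_linInterp_sub_lt hw ?_ ?_⟩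
    · have := ha _ hj (⌊w⌋₊ % m) hmod.le
      rwa [hdm] at this
    -- The right neighbour may be the end of the block, which is why `ha` includes `i = m`.
    · have := ha _ hj (⌊w⌋₊ % m + 1) hmod
      rwa [← add_assoc, hdm] at this
  obtain ⟨hju, hu'⟩ := key u hu (huv.trans_lt hv)
  obtain ⟨hjv, hv'⟩ := key v (hu.trans huv) hv
  have hle : ⌊u⌋₊ / m ≤ ⌊v⌋₊ / m := Nat.div_le_div_right (Nat.floor_le_floor huv)
  have hle' : ⌊v⌋₊ / m ≤ ⌊u⌋₊ / m + 1 := by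
    have : ⌊v⌋₊ ≤ ⌊u⌋₊ + m := by
      rw [← Nat.floor_add_natCast hu]
      exact Nat.floor_le_floor (by linarith)
    calc ⌊v⌋₊ / m ≤ (⌊u⌋₊ + m) / m := Nat.div_le_div_right this
      _ = _ := Nat.add_div_right _ hm
  -- The two points lie in the same block or in adjacent ones. The three `ε` come from each point to
  -- its block start and from one block start to the other.
  have hmid : |a (⌊v⌋₊ / m * m) - a (⌊u⌋₊ / m * m)| < ε := by
    rcases (show ⌊v⌋₊ / m = ⌊u⌋₊ / m ∨ ⌊v⌋₊ / m = ⌊u⌋₊ / m + 1 by omega) with h | h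
    · rw [h]
      simpa using ha _ hju 0 (zero_le)
    · rw [h, add_mul, one_mul]
      exact ha _ hju m le_rfl
  rw [abs_lt] at *
  rw [abs_le]
  constructor <;> linarith

end Interpolation

/-- Chernoff's bound with parameter `c / v`, then `exp x ≥ x ^ 2 / 2`. The power `v ^ 2` is what
matters: with `v = 1 / M` the bound survives a sum over `M` blocks. -/
lemma gaussianReal_le_abs_le {v : NNReal} (hv : 0 < v) {c : ℝ} (hc : 0 < c) :
    gaussianReal 0 v {x | c ≤ |x|} ≤ ENNReal.ofReal (16 * v ^ 2 / c ^ 4) := by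
  have hv' : (0 : ℝ) < v := hv
  have hexp : Real.exp (-(c ^ 2 / (2 * v))) ≤ 8 * v ^ 2 / c ^ 4 := by
    have h1 := Real.quadratic_le_exp_of_nonneg (x := c ^ 2 / (2 * v)) (by positivity)
    have h2 : c ^ 4 / (8 * v ^ 2) ≤ Real.exp (c ^ 2 / (2 * v)) := by
      refine le_trans ?_ h1
      have : (c ^ 2 / (2 * v)) ^ 2 / 2 = c ^ 4 / (8 * (v : ℝ) ^ 2) := by field_simp; ring
      rw [this]
      have : 0 ≤ c ^ 2 / (2 * (v : ℝ)) := by positivity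
      linarith
    rw [Real.exp_neg]
    exact (inv_anti₀ (by positivity) h2).trans_eq (inv_div _ _)
  have hone : ∀ Y : ℝ → ℝ, Measurable Y → (gaussianReal 0 v).map Y = gaussianReal 0 v →
      (gaussianReal 0 v).real {x | c ≤ Y x} ≤ 8 * v ^ 2 / c ^ 4 := by
    intro Y hY hmap
    have hint : Integrable (fun x => Real.exp (c / v * Y x)) (gaussianReal 0 v) := by
      have := integrable_exp_mul_gaussianReal (μ := 0) (v := v) (c / v)
      rw [← hmap] at this
      exact this.comp_measurable hY
    have := measure_ge_le_exp_mul_mgf (μ := gaussianReal 0 v) (X := Y) c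
      (t := c / v) (by positivity) hint
    rw [mgf_gaussianReal hmap, ← Real.exp_add] at this
    refine this.trans (le_trans (le_of_eq ?_) hexp)
    congr 1
    field_simp
    ring
  have hsub : {x : ℝ | c ≤ |x|} ⊆ {x | c ≤ id x} ∪ {x | c ≤ -x} := fun x hx =>
    (le_abs.1 (show c ≤ |x| from hx)).imp id id
  have h1 := hone id measurable_id Measure.map_id
  have h2 := hone (fun x => -x) measurable_neg (by rw [gaussianReal_map_neg, neg_zero])
  rw [← ofReal_measureReal]
  refine ENNReal.ofReal_le_ofReal ((measureReal_mono hsub).trans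
    ((measureReal_union_le _ _).trans ?_))
  have : 16 * (v : ℝ) ^ 2 / c ^ 4 = 8 * v ^ 2 / c ^ 4 + 8 * v ^ 2 / c ^ 4 := by ring
  rw [this]
  exact add_le_add h1 h2

/-- Ottaviani's inequality. -/
lemma measure_exists_le_abs_partialSum_le {Ω : Type*} [MeasurableSpace Ω] {P : Measure Ω}
    [IsProbabilityMeasure P] {ξ : ℕ → Ω → ℝ} (hmeas : ∀ i, Measurable (ξ i))
    (hindep : iIndepFun ξ P) {m : ℕ} {a : ℝ}
    (ha : ∀ i ≤ m, P {ω | a ≤ |partialSum ξ m ω - partialSum ξ i ω|} ≤ 1 / 2) :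
    P {ω | ∃ i ≤ m, 2 * a ≤ |partialSum ξ i ω|} ≤ 2 * P {ω | a ≤ |partialSum ξ m ω|} := by
  -- On `A i` the level `2 * a` is first reached at time `i`. This event depends on the `ξ j` with
  -- `j < i`, and `S_m - S_i` on those with `j ≥ i`.
  let A : ℕ → Set Ω := fun i =>
    {ω | 2 * a ≤ |partialSum ξ i ω|} ∩ ⋂ j ∈ Finset.range i, {ω | |partialSum ξ j ω| < 2 * a}
  let 𝓜 : ℕ → MeasurableSpace Ω := fun j => MeasurableSpace.comap (ξ j) inferInstance
  have h𝓜 : ∀ j, 𝓜 j ≤ ‹MeasurableSpace Ω› := fun j => (hmeas j).comap_le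
  have hsum : ∀ (s : Set ℕ) (S : Finset ℕ), (∀ j ∈ S, j ∈ s) →
      Measurable[⨆ j ∈ s, 𝓜 j] fun ω => ∑ j ∈ S, ξ j ω := fun s S hS =>
    Finset.measurable_fun_sum _ fun j hj =>
      (comap_measurable (ξ j)).mono (le_iSup₂_of_le j (hS j hj) le_rfl) le_rfl
  have hle : ∀ s : Set ℕ, (⨆ j ∈ s, 𝓜 j) ≤ ‹MeasurableSpace Ω› := fun s =>
    iSup₂_le fun j _ => h𝓜 j
  have hA : ∀ i, MeasurableSet[⨆ j ∈ {j | j < i}, 𝓜 j] (A i) := by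
    intro i
    have hp : ∀ l ≤ i, Measurable[⨆ j ∈ {j | j < i}, 𝓜 j] (partialSum ξ l) := fun l hl =>
      hsum _ _ fun j hj => lt_of_lt_of_le (Finset.mem_range.1 hj) hl
    refine MeasurableSet.inter ?_ (Finset.measurableSet_biInter _ fun j hj => ?_)
    · exact (measurable_norm.comp (hp i le_rfl)) measurableSet_Ici
    · exact (measurable_norm.comp (hp j (Finset.mem_range.1 hj).le)) measurableSet_Iio
  have hpart : ∀ i, Measurable (partialSum ξ i) := fun i => by
    unfold partialSum; fun_prop
  have hE : MeasurableSet {ω | a ≤ |partialSum ξ m ω|} :=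
    (measurable_norm.comp (hpart m)) measurableSet_Ici
  have hkey : ∀ i ≤ m, P (A i) ≤ 2 * P (A i ∩ {ω | a ≤ |partialSum ξ m ω|}) := by
    intro i hi
    let D : Set Ω := {ω | a ≤ |partialSum ξ m ω - partialSum ξ i ω|}
    have hD : MeasurableSet[⨆ j ∈ {j | i ≤ j}, 𝓜 j] D := by
      have e : (fun ω => partialSum ξ m ω - partialSum ξ i ω) =
          fun ω => ∑ j ∈ Finset.Ico i m, ξ j ω := by
        funext ω
        rw [partialSum, partialSum, Finset.sum_Ico_eq_sub _ hi]
      have hd : Measurable[⨆ j ∈ {j | i ≤ j}, 𝓜 j]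
          fun ω => partialSum ξ m ω - partialSum ξ i ω := by
        rw [e]
        exact hsum _ _ fun j hj => (Finset.mem_Ico.1 hj).1
      exact (measurable_norm.comp hd) measurableSet_Ici
    have hind := indep_iSup_of_disjoint h𝓜 hindep.iIndep
      (show Disjoint {j | j < i} {j | i ≤ j} from
        Set.disjoint_left.2 fun j (h1 : j < i) (h2 : i ≤ j) => absurd h1 (not_lt.2 h2))
    have hmul := (Indep_iff _ _ _).1 hind _ _ (hA i) hD.compl
    have hDc : 1 / 2 ≤ P Dᶜ := by
      rw [prob_compl_eq_one_sub (hle _ _ hD)]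
      refine le_trans ?_ (tsub_le_tsub_left (ha i hi) 1)
      rw [one_div, ENNReal.one_sub_inv_two]
    calc P (A i) = 2 * (P (A i) * (1 / 2)) := by
          rw [mul_comm (P (A i)), ← mul_assoc, one_div,
            ENNReal.mul_inv_cancel two_ne_zero ENNReal.ofNat_ne_top, one_mul]
      _ ≤ 2 * (P (A i) * P Dᶜ) := by gcongr
      _ = 2 * P (A i ∩ Dᶜ) := by rw [hmul]
      -- Starting from at least `2 * a` and moving by less than `a` leaves at least `a`.
      _ ≤ 2 * P (A i ∩ {ω | a ≤ |partialSum ξ m ω|}) := by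
          gcongr 2 * P ?_
          rintro ω ⟨hω, hωD⟩
          refine ⟨hω, ?_⟩
          have h1 : 2 * a ≤ |partialSum ξ i ω| := hω.1
          have h2 : |partialSum ξ m ω - partialSum ξ i ω| < a := not_le.1 hωD
          have h3 := abs_sub_abs_le_abs_sub (partialSum ξ i ω) (partialSum ξ m ω)
          rw [abs_sub_comm] at h3
          change a ≤ |partialSum ξ m ω|
          linarith
  have hdisj : (↑(Finset.range (m + 1)) : Set ℕ).PairwiseDisjoint
      fun i => A i ∩ {ω | a ≤ |partialSum ξ m ω|} := by
    have key : ∀ i j, i < j → Disjoint (A i) (A j) := fun i j hij =>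
      Set.disjoint_left.2 fun ω hi hj => by
        have h1 : 2 * a ≤ |partialSum ξ i ω| := hi.1
        have h2 : |partialSum ξ i ω| < 2 * a :=
          Set.mem_iInter₂.1 hj.2 i (Finset.mem_range.2 hij)
        linarith
    intro i _ j _ hij
    refine Disjoint.mono Set.inter_subset_left Set.inter_subset_left ?_
    rcases lt_or_gt_of_ne hij with h | h
    · exact key i j h
    · exact (key j i h).symm
  calc P {ω | ∃ i ≤ m, 2 * a ≤ |partialSum ξ i ω|}
      ≤ P (⋃ i ∈ Finset.range (m + 1), A i) := by
        refine measure_mono fun ω hω => ?_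
        classical
        have hex : ∃ i, 2 * a ≤ |partialSum ξ i ω| := hω.imp fun i hi => hi.2
        obtain ⟨i, him, hi⟩ := hω
        refine Set.mem_iUnion₂.2 ⟨Nat.find hex, ?_, Nat.find_spec hex, ?_⟩
        · exact Finset.mem_range.2 (Nat.lt_succ_of_le ((Nat.find_le hi).trans him))
        · exact Set.mem_iInter₂.2 fun j hj => not_le.1 (Nat.find_min hex (Finset.mem_range.1 hj))
    _ ≤ ∑ i ∈ Finset.range (m + 1), P (A i) := measure_biUnion_finset_le _ _
    _ ≤ ∑ i ∈ Finset.range (m + 1), 2 * P (A i ∩ {ω | a ≤ |partialSum ξ m ω|}) :=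
        Finset.sum_le_sum fun i hi => hkey i (Nat.lt_succ_iff.1 (Finset.mem_range.1 hi))
    _ = 2 * P (⋃ i ∈ Finset.range (m + 1), A i ∩ {ω | a ≤ |partialSum ξ m ω|}) := by
        rw [← Finset.mul_sum, measure_biUnion_finset hdisj fun i _ => (hle _ _ (hA i)).inter hE]
    _ ≤ 2 * P {ω | a ≤ |partialSum ξ m ω|} := by
        gcongr 2 * P ?_
        exact Set.iUnion₂_subset fun i _ => Set.inter_subset_right

/-! ### Tightness of the scaled walks. -/

lemma tendsto_card_block (M : ℕ) :
    Tendsto (fun n : ℕ => ((Finset.range (n / M + 1)).card : ℝ) / n) atTop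
      (𝓝 ((1 / M : NNReal) : ℝ)) := by
  have h1 := (tendsto_nat_floor_mul_div_atTop (R := ℝ) (a := 1 / M) (by positivity)).comp
    tendsto_natCast_atTop_atTop
  have h2 := h1.add (tendsto_one_div_atTop_nhds_zero_nat (𝕜 := ℝ))
  rw [add_zero] at h2
  push_cast
  refine h2.congr fun n => ?_
  have : ⌊(1 / M : ℝ) * n⌋₊ = n / M := by
    rw [one_div_mul_eq_div, Nat.floor_div_natCast, Nat.floor_natCast]
  simp only [Function.comp, this, Finset.card_range]
  push_cast
  ring

/-- Outside the event of large oscillation over a block, the modulus of continuity is small. -/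
lemma scaledWalk_mem_modulusLE {Ω : Type*} {ξ : ℕ → Ω → ℝ} {M : ℕ} (hM : 0 < M) {ε : ℝ} {n : ℕ} (hn : 0 < n) {ω : Ω}
    (hω : ¬ ∃ j < M, ∃ i ≤ n / M + 1, 2 * (ε * √n) ≤
        |partialSum ξ (j * (n / M + 1) + i) ω - partialSum ξ (j * (n / M + 1)) ω|) :
    scaledWalk ξ 1 n ω ∈ modulusLE (1 / M) (6 * ε) := by
  have hM' : (0 : ℝ) < M := by exact_mod_cast hM
  have hn0 : (0 : ℝ) < n := by exact_mod_cast hn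
  have hn' : (0 : ℝ) < √n := Real.sqrt_pos.2 hn0
  push Not at hω
  set m := n / M + 1 with hm
  -- The `+ 1` in the block length makes `M` blocks reach strictly beyond `n`.
  have hnm : n < M * m := by
    rw [hm, mul_comm]
    exact Nat.lt_mul_of_div_lt (Nat.lt_succ_self _) hM
  have hnm' : (n : ℝ) < M * m := by exact_mod_cast hnm
  have ha : ∀ j < M, ∀ i ≤ m, |partialSum ξ (j * m + i) ω / (1 * √n) -
      partialSum ξ (j * m) ω / (1 * √n)| < 2 * ε := by
    intro j hj i hi
    rw [← sub_div, one_mul, abs_div, abs_of_pos hn', div_lt_iff₀ hn', mul_assoc]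
    exact hω j hj i hi
  have key : ∀ s t : unitInterval, (s : ℝ) ≤ t → (t : ℝ) - s ≤ 1 / M →
      |scaledWalk ξ 1 n ω s - scaledWalk ξ 1 n ω t| ≤ 6 * ε := by
    intro s t hst hd
    have := abs_linInterp_sub_linInterp_le (m := m)
      (a := fun i => partialSum ξ i ω / (1 * √n)) (Nat.succ_pos _) ha
      (u := n * s) (v := n * t) (mul_nonneg n.cast_nonneg s.2.1) (by gcongr)
      ((mul_le_of_le_one_right n.cast_nonneg t.2.2).trans_lt hnm') (by
        rw [← mul_sub]
        refine (mul_le_mul_of_nonneg_left hd n.cast_nonneg).trans ?_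
        rw [mul_one_div, div_le_iff₀ hM']
        linarith)
    refine this.trans (by linarith)
  intro s t hst
  rcases le_total (s : ℝ) t with hle | hle
  · exact key s t hle (by rw [abs_sub_comm] at hst; exact (le_abs_self _).trans hst)
  · rw [abs_sub_comm]
    exact key t s hle ((le_abs_self _).trans hst)

namespace IsStandardIID

variable {Ω : Type*} [MeasurableSpace Ω] {P : Measure Ω} {ξ : ℕ → Ω → ℝ}

lemma shift (h : IsStandardIID ξ P) (l : ℕ) : IsStandardIID (fun i => ξ (l + i)) P where
  meas _ := h.meas _
  indep := h.indep.precomp (g := fun i => l + i) (add_right_injective l)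
  ident _ := (h.ident _).trans (h.ident _).symm
  memLp_zero := h.memLp _
  mean_zero := h.mean _
  variance_zero := h.variance _

variable [IsProbabilityMeasure P]

/-- The sum over a block of length about `n / M` exceeds `ε * √n` with probability `O(M⁻²)`. -/
lemma eventually_measure_block_le (h : IsStandardIID ξ P) {M : ℕ} (hM : 0 < M) {ε : ℝ}
    (hε : 0 < ε) :
    ∀ᶠ n : ℕ in atTop, P {ω | ε * √n ≤ |∑ j ∈ Finset.range (n / M + 1), ξ j ω|} ≤
      ENNReal.ofReal (32 / (M ^ 2 * ε ^ 4)) := by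
  have hM' : (0 : ℝ) < M := by exact_mod_cast hM
  have hlim := tendsto_map_inv_sqrt_mul_sum h.meas h.indep h.ident h.mean_zero h.second_moment
    (tendsto_card_block M)
  have hF : IsClosed {x : ℝ | ε ≤ |x|} := isClosed_le continuous_const continuous_abs
  have hlimsup := ProbabilityMeasure.limsup_measure_closed_le_of_tendsto hlim hF
  -- The tail bound gives `16`; the larger `32` leaves the strict inequality needed to pass from the
  -- limsup to eventually all `n`.
  have hbound : gaussianReal 0 (1 / M : NNReal) {x : ℝ | ε ≤ |x|} <
      ENNReal.ofReal (32 / (M ^ 2 * ε ^ 4)) := by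
    refine (gaussianReal_le_abs_le (by positivity) hε).trans_lt
      ((ENNReal.ofReal_lt_ofReal_iff (by positivity)).2 ?_)
    push_cast
    have : 16 * (1 / (M : ℝ)) ^ 2 / ε ^ 4 = 16 / (M ^ 2 * ε ^ 4) := by field_simp
    rw [this]
    gcongr
    norm_num
  have hev := eventually_lt_of_limsup_lt (hlimsup.trans_lt hbound)
  filter_upwards [hev, eventually_gt_atTop 0] with n hn hn0
  refine le_trans (le_of_eq ?_) hn.le
  have hn' : (0 : ℝ) < √n := Real.sqrt_pos.2 (by exact_mod_cast hn0)
  change _ = P.map (fun ω => (√n)⁻¹ * ∑ j ∈ Finset.range (n / M + 1), ξ j ω) {x : ℝ | ε ≤ |x|}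
  rw [Measure.map_apply ((h.measurable_sum _).const_mul _) hF.measurableSet]
  congr 1
  ext ω
  simp only [Set.mem_ofPred_eq, Set.mem_preimage]
  rw [abs_mul, abs_inv, abs_of_pos hn', le_inv_mul_iff₀ hn', mul_comm]

/-- The probability that the walk oscillates by more than `2 * ε * √n` over some block. -/
lemma eventually_measure_exists_block_le (h : IsStandardIID ξ P) {M : ℕ} (hM : 0 < M) {ε : ℝ}
    (hε : 0 < ε) (hMε : 4 ≤ M * ε ^ 2) :
    ∀ᶠ n : ℕ in atTop, P {ω | ∃ j < M, ∃ i ≤ n / M + 1, 2 * (ε * √n) ≤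
        |partialSum ξ (j * (n / M + 1) + i) ω - partialSum ξ (j * (n / M + 1)) ω|} ≤
      ENNReal.ofReal (64 / (M * ε ^ 4)) := by
  have hM' : (0 : ℝ) < M := by exact_mod_cast hM
  filter_upwards [h.eventually_measure_block_le hM hε, eventually_ge_atTop M] with n hn hnM
  have hn0 : 0 < n := hM.trans_le hnM
  have hn' : (0 : ℝ) < √n := Real.sqrt_pos.2 (by exact_mod_cast hn0)
  set m := n / M + 1 with hm
  have hmn : (m : ℝ) ≤ 2 * n / M := by
    rw [le_div_iff₀ hM']
    have h1 : n / M * M ≤ n := Nat.div_mul_le_self n M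
    have h2 : m * M ≤ 2 * n := by rw [hm, add_mul]; omega
    exact_mod_cast h2
  have hblock : ∀ j, P {ω | ∃ i ≤ m, 2 * (ε * √n) ≤
      |partialSum ξ (j * m + i) ω - partialSum ξ (j * m) ω|} ≤
      2 * ENNReal.ofReal (32 / (M ^ 2 * ε ^ 4)) := by
    intro j
    have hs := h.shift (j * m)
    have hps : ∀ i ω, partialSum ξ (j * m + i) ω - partialSum ξ (j * m) ω =
        partialSum (fun i => ξ (j * m + i)) i ω := fun i ω => by
      simp [partialSum, Finset.sum_range_add]
    simp only [hps]
    refine (measure_exists_le_abs_partialSum_le hs.meas hs.indep fun i hi => ?_).trans ?_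
    · have e : ∀ ω, partialSum (fun i => ξ (j * m + i)) m ω -
          partialSum (fun i => ξ (j * m + i)) i ω = ∑ l ∈ Finset.Ico i m, ξ (j * m + l) ω :=
        fun ω => by rw [partialSum, partialSum, Finset.sum_Ico_eq_sub _ hi]
      simp only [e]
      refine (hs.measure_le_abs_sum _ (mul_pos hε hn')).trans ?_
      have h12 : (1 / 2 : ENNReal) = ENNReal.ofReal (1 / 2) := by
        rw [ENNReal.ofReal_div_of_pos two_pos]; simp
      rw [h12]
      refine ENNReal.ofReal_le_ofReal ?_
      -- Ottaviani's condition: Chebyshev gives at most `m / (ε ^ 2 * n) ≤ 2 / (M * ε ^ 2)`, and `4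
      -- ≤ M * ε ^ 2` makes this at most `1 / 2`.
      rw [mul_pow, Real.sq_sqrt n.cast_nonneg, Nat.card_Ico, div_le_iff₀ (by positivity)]
      have h1 : ((m - i : ℕ) : ℝ) ≤ m := by exact_mod_cast Nat.sub_le m i
      have h2 : 2 * (n : ℝ) / M ≤ 1 / 2 * (ε ^ 2 * n) := by
        rw [div_le_iff₀ hM']
        have : (0 : ℝ) ≤ n := n.cast_nonneg
        nlinarith
      linarith
    · gcongr
      refine le_trans (le_of_eq ?_) hn
      have hF : MeasurableSet {x : ℝ | ε * √n ≤ |x|} :=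
        measurableSet_le measurable_const measurable_norm
      have hcard : (Finset.Ico (j * m) (j * m + m)).card = (Finset.range m).card := by simp
      have hlaw := congrArg (fun μ : Measure ℝ => μ {x : ℝ | ε * √n ≤ |x|})
        (map_sum_eq_of_card_eq h.meas h.indep h.ident hcard)
      simp only [Measure.map_apply (h.measurable_sum _) hF, Set.preimage_ofPred_eq] at hlaw
      rw [← hlaw]
      simp [partialSum, Finset.sum_Ico_eq_sum_range]
  calc _ ≤ P (⋃ j ∈ Finset.range M, {ω | ∃ i ≤ m, 2 * (ε * √n) ≤
        |partialSum ξ (j * m + i) ω - partialSum ξ (j * m) ω|}) := by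
        refine measure_mono fun ω ⟨j, hj, hω⟩ => Set.mem_iUnion₂.2 ⟨j, Finset.mem_range.2 hj, hω⟩
    _ ≤ ∑ j ∈ Finset.range M, 2 * ENNReal.ofReal (32 / (M ^ 2 * ε ^ 4)) :=
        (measure_biUnion_finset_le _ _).trans (Finset.sum_le_sum fun j _ => hblock j)
    _ = ENNReal.ofReal (64 / (M * ε ^ 4)) := by
        rw [Finset.sum_const, Finset.card_range, nsmul_eq_mul, ← ENNReal.ofReal_natCast,
          show (2 : ENNReal) = ENNReal.ofReal 2 by simp, ← ENNReal.ofReal_mul (by positivity),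
          ← ENNReal.ofReal_mul (by positivity)]
        congr 1
        field_simp
        norm_num

lemma exists_eventually_measure_compl_modulusLE_le (h : IsStandardIID ξ P) {ε : ℝ} (hε : 0 < ε)
    {η : ENNReal} (hη : 0 < η) :
    ∃ δ > 0, ∀ᶠ n in atTop, P.map (scaledWalk ξ 1 n) (modulusLE δ ε)ᶜ ≤ η := by
  -- The factor `6` is lost in `scaledWalk_mem_modulusLE`: three block oscillations of size `2 *
  -- ε'`.
  set ε' := ε / 6 with hε'
  have hε'0 : 0 < ε' := by positivity
  have hlim : Tendsto (fun M : ℕ => ENNReal.ofReal (64 / (M * ε' ^ 4))) atTop (𝓝 0) := by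
    have h1 := (tendsto_one_div_atTop_nhds_zero_nat (𝕜 := ℝ)).const_mul (64 / ε' ^ 4)
    rw [mul_zero] at h1
    have h2 := ENNReal.tendsto_ofReal h1
    rw [ENNReal.ofReal_zero] at h2
    refine h2.congr fun M => ?_
    congr 1
    rw [div_mul_div_comm, mul_one, mul_comm]
  obtain ⟨M, hMη, hM, hMε⟩ := ((hlim.eventually_lt_const hη).and ((eventually_gt_atTop 0).and
    ((tendsto_natCast_atTop_atTop (R := ℝ)).eventually_ge_atTop (4 / ε' ^ 2)))).exists
  rw [div_le_iff₀ (by positivity)] at hMε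
  refine ⟨1 / M, by positivity, ?_⟩
  filter_upwards [h.eventually_measure_exists_block_le hM hε'0 hMε, eventually_gt_atTop 0]
    with n hn hn0
  rw [Measure.map_apply (measurable_scaledWalk h.meas 1 n)
    (isClosed_modulusLE _ _).measurableSet.compl]
  refine le_trans (measure_mono fun ω hω => ?_) (hn.trans hMη.le)
  by_contra hcon
  have := scaledWalk_mem_modulusLE (ε := ε') hM hn0 hcon
  rw [show 6 * ε' = ε by rw [hε']; ring] at this
  exact hω this

/-- The laws of the scaled walks are tight. -/
lemma isTightMeasureSet_scaledWalk (h : IsStandardIID ξ P) :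
    IsTightMeasureSet {Q | ∃ n : ℕ, P.map (scaledWalk ξ 1 n) = Q} := by
  have hmeas := measurable_scaledWalk h.meas 1
  have := fun n => Measure.isProbabilityMeasure_map (μ := P) (hmeas n).aemeasurable
  refine isTightMeasureSet_of_modulus ?_ ?_
  · rintro _ ⟨n, rfl⟩
    have hc : IsClosed {x : C(unitInterval, ℝ) | x 0 = 0} :=
      isClosed_eq (by fun_prop) continuous_const
    rw [Measure.map_apply (hmeas n) hc.measurableSet.compl]
    convert measure_empty (μ := P)
    ext ω
    simp [scaledWalk_apply, partialSum]
  · intro ε hε η hη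
    obtain ⟨δ, hδ, hev⟩ := h.exists_eventually_measure_compl_modulusLE_le hε hη
    obtain ⟨N, hN⟩ := eventually_atTop.1 hev
    obtain ⟨δ', hδ', hlt⟩ := exists_forall_lt_measure_compl_modulusLE_le
      (fun n => P.map (scaledWalk ξ 1 n)) hε hη N
    refine ⟨min δ δ', lt_min hδ hδ', ?_⟩
    rintro _ ⟨n, rfl⟩
    rcases lt_or_ge n N with hn | hn
    · exact (measure_mono (Set.compl_subset_compl.2
        (modulusLE_antitone (min_le_right _ _) ε))).trans (hlt n hn)
    · exact (measure_mono (Set.compl_subset_compl.2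
        (modulusLE_antitone (min_le_left _ _) ε))).trans (hN n hn)

end IsStandardIID

/-! ### Uniqueness and existence of Wiener measure, and convergence to it. -/

/-- Two Wiener measures give the same joint law to any finite family of coordinates. -/
lemma IsWienerMeasure.map_eval_eq {W W' : ProbabilityMeasure C(unitInterval, ℝ)}
    (hW : IsWienerMeasure W) (hW' : IsWienerMeasure W') {ι : Type*} [Finite ι]
    (τ : ι → unitInterval) :
    (W : Measure C(unitInterval, ℝ)).map (fun x i => x (τ i)) =
      (W' : Measure C(unitInterval, ℝ)).map (fun x i => x (τ i)) := by
  classical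
  have := Fintype.ofFinite ι
  -- The times `τ i` may be unordered or repeated; sorting their image gives monotone times, from
  -- which the coordinates are read off through `r`.
  let S : Finset unitInterval := Finset.univ.image τ
  let e := S.orderIsoOfFin rfl
  let t : Fin S.card → unitInterval := fun i => e i
  have ht : Monotone t := fun i j hij => e.monotone hij
  let r : ι → Fin S.card := fun i => e.symm ⟨τ i, Finset.mem_image_of_mem τ (Finset.mem_univ i)⟩
  have hr : ∀ i, t (r i) = τ i := fun i => by simp [t, r]
  have hcomp : (fun (x : C(unitInterval, ℝ)) i => x (τ i)) =
      (fun (y : Fin S.card → ℝ) i => y (r i)) ∘ timeProj t := by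
    funext x i
    simp [timeProj, hr]
  have hm : Measurable fun (y : Fin S.card → ℝ) i => y (r i) := by fun_prop
  rw [hcomp, ← Measure.map_map hm (continuous_timeProj t).measurable,
    ← Measure.map_map hm (continuous_timeProj t).measurable, (hW _ t ht).eq_wienerMarginal ht,
    (hW' _ t ht).eq_wienerMarginal ht]

/-- Wiener measure is unique. -/
lemma IsWienerMeasure.unique {W W' : ProbabilityMeasure C(unitInterval, ℝ)}
    (hW : IsWienerMeasure W) (hW' : IsWienerMeasure W') : W = W' := by
  obtain ⟨d, hd⟩ := TopologicalSpace.exists_dense_seq unitInterval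
  let f : C(unitInterval, ℝ) → ℕ → ℝ := fun x n => x (d n)
  have hf : Continuous f := continuous_pi fun n => continuous_eval_const (d n)
  have hinj : Function.Injective f := fun x y hxy =>
    DFunLike.coe_injective (Continuous.ext_on hd x.continuous y.continuous (by
      rintro _ ⟨n, rfl⟩
      exact congrFun hxy n))
  -- A continuous injection between Polish spaces is a measurable embedding, so it suffices to
  -- compare the images in `ℝ^ℕ`, which are fixed by their finite marginals.
  refine Subtype.ext ((hf.measurableEmbedding hinj).map_injective ?_)
  refine IsProjectiveLimit.unique
    (P := fun J => ((W : Measure C(unitInterval, ℝ)).map f).map J.restrict) (fun _ => rfl)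
    fun J => ?_
  change ((W' : Measure C(unitInterval, ℝ)).map f).map J.restrict =
    ((W : Measure C(unitInterval, ℝ)).map f).map J.restrict
  rw [Measure.map_map (Finset.measurable_restrict J) hf.measurable,
    Measure.map_map (Finset.measurable_restrict J) hf.measurable]
  exact hW'.map_eval_eq hW fun j : J => d j

namespace IsStandardIID

variable {Ω : Type*} [MeasurableSpace Ω] {P : Measure Ω} [IsProbabilityMeasure P] {ξ : ℕ → Ω → ℝ}

/-- The law of the scaled walk as a probability measure on `C[0,1]`. -/
noncomputable def walkLaw (h : IsStandardIID ξ P) (n : ℕ) : ProbabilityMeasure C(unitInterval, ℝ) :=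
  ⟨P.map (scaledWalk ξ 1 n),
    Measure.isProbabilityMeasure_map (measurable_scaledWalk h.meas 1 n).aemeasurable⟩

lemma isCompact_closure_range_walkLaw (h : IsStandardIID ξ P) :
    IsCompact (closure (Set.range h.walkLaw)) := by
  refine isCompact_closure_of_isTightMeasureSet (h.isTightMeasureSet_scaledWalk.subset ?_)
  rintro _ ⟨_, ⟨n, rfl⟩, rfl⟩
  exact ⟨n, rfl⟩

/-- Every cluster point of the laws of the scaled walks is a Wiener measure. -/
lemma isWienerMeasure_of_mapClusterPt (h : IsStandardIID ξ P)
    {W : ProbabilityMeasure C(unitInterval, ℝ)} (hW : MapClusterPt W atTop h.walkLaw) :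
    IsWienerMeasure W := by
  intro k t ht
  have hc := continuous_timeProj t
  have hcl := hW.continuousAt_comp (ProbabilityMeasure.continuous_map hc).continuousAt
  have hlim : Tendsto ((fun ν : ProbabilityMeasure C(unitInterval, ℝ) =>
      ν.map hc.measurable.aemeasurable) ∘ h.walkLaw) atTop (𝓝 (wienerMarginal t)) := by
    refine Tendsto.congr (fun n => Subtype.ext ?_)
      ((h.tendstoInDistribution_timeProj ht).tendsto.trans
        (le_of_eq (congrArg 𝓝 (Subtype.ext Measure.map_id))))
    exact (Measure.map_map hc.measurable (measurable_scaledWalk h.meas 1 n)).symm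
  -- The marginal of `W` is a cluster point of a convergent sequence, hence its limit.
  have heq : W.map hc.measurable.aemeasurable = wienerMarginal t :=
    eq_of_nhds_neBot (hcl.neBot.mono (inf_le_inf_left _ hlim))
  have := isWienerMarginal_wienerMarginal ht
  rwa [← heq] at this

/-- Wiener measure arises here as a cluster point of the walk laws, which exists by compactness. -/
lemma exists_isWienerMeasure (h : IsStandardIID ξ P) :
    ∃ W : ProbabilityMeasure C(unitInterval, ℝ), IsWienerMeasure W := by
  obtain ⟨W, -, hW⟩ := h.isCompact_closure_range_walkLaw.exists_mapClusterPt (f := atTop)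
    (u := h.walkLaw) (tendsto_principal.2 (Eventually.of_forall fun n => subset_closure ⟨n, rfl⟩))
  exact ⟨W, h.isWienerMeasure_of_mapClusterPt hW⟩

/-- Convergence in distribution of the scaled walk to the Wiener process. -/
lemma tendstoInDistribution_scaledWalk (h : IsStandardIID ξ P)
    {W : ProbabilityMeasure C(unitInterval, ℝ)} (hW : IsWienerMeasure W) :
    TendstoInDistribution (scaledWalk ξ 1) atTop (id : C(unitInterval, ℝ) → C(unitInterval, ℝ))
      (fun _ => P) (W : Measure C(unitInterval, ℝ)) := by
  refine ⟨fun n => (measurable_scaledWalk h.meas 1 n).aemeasurable, aemeasurable_id, ?_⟩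
  have hlim : Tendsto h.walkLaw atTop (𝓝 W) :=
    h.isCompact_closure_range_walkLaw.tendsto_nhds_of_unique_mapClusterPt
      (Eventually.of_forall fun n => subset_closure ⟨n, rfl⟩)
      fun V _ hV => (h.isWienerMeasure_of_mapClusterPt hV).unique hW
  exact hlim.trans (le_of_eq (congrArg 𝓝 (Subtype.ext Measure.map_id.symm)))

end IsStandardIID

lemma scaledWalk_eq_scaledWalk_div {Ω : Type*} (ξ : ℕ → Ω → ℝ) (σ : ℝ) :
    scaledWalk ξ σ = scaledWalk (fun i ω => ξ i ω / σ) 1 := by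
  funext n ω
  simp only [scaledWalk, partialSum, one_mul, ← Finset.sum_div, div_div]

theorem theorem8p2 {Ω : Type*} [MeasurableSpace Ω] (P : Measure Ω) [IsProbabilityMeasure P]
    (ξ : ℕ → Ω → ℝ) (hmeas : ∀ i, Measurable (ξ i))
    (hindep : iIndepFun ξ P) (hident : ∀ i, IdentDistrib (ξ i) (ξ 0) P P)
    (hL2 : MemLp (ξ 0) 2 P) (hmean : ∫ ω, ξ 0 ω ∂P = 0)
    (σ : ℝ) (hσ : 0 < σ) (hvar : variance (ξ 0) P = σ ^ 2) :
    (∀ (k : ℕ) (t : Fin k → unitInterval), Monotone t →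
      ∃ μ : ProbabilityMeasure (Fin k → ℝ), IsWienerMarginal t (μ : Measure (Fin k → ℝ)) ∧
        TendstoInDistribution (fun n ω => timeProj t (scaledWalk ξ σ n ω)) atTop
          (id : (Fin k → ℝ) → (Fin k → ℝ)) (fun _ => P) (μ : Measure (Fin k → ℝ))) ∧
    IsTightMeasureSet {Q : Measure C(unitInterval, ℝ) | ∃ n : ℕ, 1 ≤ n ∧ Q = P.map (scaledWalk ξ σ n)} ∧
    (∃! W : ProbabilityMeasure C(unitInterval, ℝ), IsWienerMeasure W) ∧
    (∀ W : ProbabilityMeasure C(unitInterval, ℝ), IsWienerMeasure W →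
      TendstoInDistribution (scaledWalk ξ σ) atTop (id : C(unitInterval, ℝ) → C(unitInterval, ℝ))
        (fun _ => P) (W : Measure C(unitInterval, ℝ))) := by
  have h : IsStandardIID (fun i ω => ξ i ω / σ) P :=
    { meas := fun i => (hmeas i).div_const σ
      indep := hindep.comp (fun _ x => x / σ) fun _ => by fun_prop
      ident := fun i => (hident i).comp (u := fun x => x / σ) (by fun_prop)
      memLp_zero := by simpa [div_eq_mul_inv] using hL2.mul_const σ⁻¹
      mean_zero := by rw [integral_div, hmean, zero_div]
      variance_zero := by
        simp only [div_eq_inv_mul]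
        rw [variance_const_mul, hvar]
        field_simp }
  rw [scaledWalk_eq_scaledWalk_div ξ σ]
  refine ⟨fun k t ht => ⟨wienerMarginal t, isWienerMarginal_wienerMarginal ht,
    h.tendstoInDistribution_timeProj ht⟩, ?_, ?_,
    fun W hW => h.tendstoInDistribution_scaledWalk hW⟩
  -- The tight family also contains the law for `n = 0`, so it includes the one required.
  · refine h.isTightMeasureSet_scaledWalk.subset ?_
    rintro _ ⟨n, -, rfl⟩
    exact ⟨n, rfl⟩
  · obtain ⟨W, hW⟩ := h.exists_isWienerMeasure
    exact ⟨W, hW, fun V hV => IsWienerMeasure.unique hV hW⟩
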